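/- Let $n\ge 1$. For $0<r<1$ and $x,y\in\mathbb R^n$ let $M_r(x,y)=(1-r^2)^{-n/2}\exp\left(-\frac{|y-rx|^2}{1-r^2}\right)$ be the Mehler kernel, and for $t>0$ let $$P_t(x,y)=\frac1{\sqrt\pi}\int_0^\infty \frac{e^{-u}}{\sqrt u}\,\pi^{-n/2}M_{e^{-t^2/(4u)}}(x,y)\,du=\frac1{2\pi^{(n+1)/2}}\int_0^\infty \frac{t}{s^{3/2}}\,e^{-\frac{t^2}{4s}}\,\frac{e^{-\frac{|y-e^{-s}x|^2}{1-e^{-2s}}}}{(1-e^{-2s})^{n/2}}\,ds$$ be the Ornstein–Uhlenbeck Poisson kernel. For $x\neq0$ write $y=y_x+y_x'$ with $y_x$ parallel and $y_x'$ orthogonal to $x$; for $x=0$ put $y_x=y$, $y_x'=0$. For $c>0$, write \begin{align*} K_1(t,x,y)&=\frac t{(t^2+|x-y|^2)^{(n+1)/2}}\,e^{-c\,t(1+|x|)},\\ K_2(t,x,y)&=\frac t{|x|}\left(t^2+\frac{|x-y_x|}{|x|}+|y_x'|^2\right)^{-\frac{n+2}2}\exp\left(-c\,\frac{(t^2+|y_x'|^2)|x|}{|x-y_x|}\right)\chi_{\{|x|>1,\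 x\cdot y>0,\ |x|/2\le|y_x|<|x|\}},\\ K_3(t,x,y)&=\min(1,t)\,e^{-c|y|^2},\\ K_4(t,x,y)&=\frac t{|y_x|}\left(\log\frac{|x|}{|y_x|}\right)^{-\frac32}\exp\left(-c\,\frac{t^2}{\log\frac{|x|}{|y_x|}}\right)e^{-c|y_x'|^2}\,\chi_{\{x\cdot y>0,\ 1<|y_x|<|x|/2\}}. \end{align*} Theorem 1.3. There are constants $C,c>0$ depending only on $n$ such that for all $i\in\{1,\dots,n\}$, $t>0$ and $x,y\in\mathbb R^n$, the integral defining $P_t(x,y)$ in the variable $u$ converges absolutely, the partial derivatives $\partial_tP_t(x,y)$ and $\partial_{x_i}P_t(x,y)$ exist, and $$|t\,\partial_tP_t(x,y)|+|t\,\partial_{x_i}P_t(x,y)|\le C\left[K_1(t,x,y)+K_2(t,x,y)+K_3(t,x,y)+K_4(t,x,y)\right].$$ -/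

import Mathlib

noncomputable section

/-- The Mehler kernel `M_r(x, y) = (1 - r²)^{-n/2} exp(-|y - r x|² / (1 - r²))`, `0 < r < 1`,
on `ℝⁿ` with the Euclidean norm. -/
def mehlerKernel {n : ℕ} (r : ℝ) (x y : EuclideanSpace ℝ (Fin n)) : ℝ :=
  Real.exp (-(‖y - r • x‖ ^ 2 / (1 - r ^ 2))) / (1 - r ^ 2) ^ ((n : ℝ) / 2)

/-- The kernel, with respect to Lebesgue measure, of the Ornstein-Uhlenbeck semigroup
`T_s = e^{-sL}`, `s > 0`. -/
def ouKernel {n : ℕ} (s : ℝ) (x y : EuclideanSpace ℝ (Fin n)) : ℝ :=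
  Real.pi ^ (-((n : ℝ) / 2)) * mehlerKernel (Real.exp (-s)) x y

/-- The integrand of the subordination formula
`P_t(x, y) = π^{-1/2} ∫₀^∞ e^{-u} u^{-1/2} T_{t²/(4u)}(x, y) du`. -/
def ouPoissonIntegrand {n : ℕ} (t : ℝ) (x y : EuclideanSpace ℝ (Fin n)) (u : ℝ) : ℝ :=
  Real.exp (-u) / √u * ouKernel (t ^ 2 / (4 * u)) x y

/-- The Ornstein-Uhlenbeck Poisson kernel `P_t(x, y)`, `t > 0`, defined by subordination. -/
def ouPoissonKernel {n : ℕ} (t : ℝ) (x y : EuclideanSpace ℝ (Fin n)) : ℝ :=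
  1 / √Real.pi * ∫ u in Set.Ioi (0 : ℝ), ouPoissonIntegrand t x y u

/-- The explicit formula for `P_t(x, y)` after the change of variables `s = t² / (4u)`. -/
theorem ouPoissonKernel_eq {n : ℕ} {t : ℝ} (ht : 0 < t) (x y : EuclideanSpace ℝ (Fin n)) :
    ouPoissonKernel t x y = 1 / (2 * Real.pi ^ (((n : ℝ) + 1) / 2)) *
      ∫ s in Set.Ioi (0 : ℝ), t / s ^ (3 / 2 : ℝ) * Real.exp (-(t ^ 2 / (4 * s))) *
        (Real.exp (-(‖y - Real.exp (-s) • x‖ ^ 2 / (1 - Real.exp (-(2 * s))))) /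
          (1 - Real.exp (-(2 * s))) ^ ((n : ℝ) / 2)) := by
  have himg : (fun s : ℝ => t ^ 2 / (4 * s)) '' Set.Ioi 0 = Set.Ioi 0 := by
    ext u
    constructor
    · rintro ⟨s, hs, rfl⟩
      have hs' : 0 < s := hs
      exact Set.mem_Ioi.2 (by positivity)
    · intro hu
      have hu' : 0 < u := hu
      refine ⟨t ^ 2 / (4 * u), Set.mem_Ioi.2 (by positivity), ?_⟩
      simp only
      field_simp
  have hder : ∀ s ∈ Set.Ioi (0 : ℝ),
      HasDerivWithinAt (fun s : ℝ => t ^ 2 / (4 * s)) (-(t ^ 2 / (4 * s ^ 2))) (Set.Ioi 0) s := by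
    intro s hs
    have hs' : s ≠ 0 := ne_of_gt hs
    have h := ((hasDerivAt_inv hs').const_mul (t ^ 2 / 4)).hasDerivWithinAt (s := Set.Ioi 0)
    refine (h.congr_deriv (by field_simp)).congr (fun z _ => ?_) ?_ <;>
    · simp only [div_eq_mul_inv, mul_inv]
      ring
  have hinj : Set.InjOn (fun s : ℝ => t ^ 2 / (4 * s)) (Set.Ioi 0) := by
    intro a ha b hb hab
    have ha' : 0 < a := ha
    have hb' : 0 < b := hb
    simp only at hab
    field_simp at hab
    exact hab.symm
  unfold ouPoissonKernel
  conv_lhs => rw [← himg]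
  rw [MeasureTheory.integral_image_eq_integral_abs_deriv_smul measurableSet_Ioi hder hinj,
    ← MeasureTheory.integral_const_mul, ← MeasureTheory.integral_const_mul]
  refine MeasureTheory.setIntegral_congr_fun measurableSet_Ioi fun s hs => ?_
  have hs' : 0 < s := hs
  have h1 : t ^ 2 / (4 * (t ^ 2 / (4 * s))) = s := by field_simp
  have h2 : Real.exp (-s) ^ 2 = Real.exp (-(2 * s)) := by
    rw [← Real.exp_nat_mul]; congr 1; push_cast; ring
  have h3 : √(t ^ 2 / (4 * s)) = t / (2 * √s) := by
    rw [Real.sqrt_eq_iff_mul_self_eq_of_pos (by positivity)]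
    field_simp
    rw [Real.sq_sqrt hs'.le]; ring
  have h4 : s ^ (3 / 2 : ℝ) = s * √s := by
    rw [Real.sqrt_eq_rpow, show (3 / 2 : ℝ) = 1 + 1 / 2 by norm_num, Real.rpow_add hs',
      Real.rpow_one]
  have h5 : Real.pi ^ (((n : ℝ) + 1) / 2) = Real.pi ^ ((n : ℝ) / 2) * √Real.pi := by
    rw [Real.sqrt_eq_rpow, ← Real.rpow_add Real.pi_pos]; congr 1; ring
  have h6 : √s * √s = s := Real.mul_self_sqrt hs'.le
  simp only [ouPoissonIntegrand, ouKernel, mehlerKernel, smul_eq_mul]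
  rw [h1, h2, h3, h4, h5, abs_neg, abs_of_nonneg (by positivity), Real.rpow_neg Real.pi_pos.le]
  generalize Real.exp (-(‖y - Real.exp (-s) • x‖ ^ 2 / (1 - Real.exp (-(2 * s))))) /
          (1 - Real.exp (-(2 * s))) ^ ((n : ℝ) / 2) = m
  have hpi : Real.pi ^ ((n : ℝ) / 2) ≠ 0 := (Real.rpow_pos_of_pos Real.pi_pos _).ne'
  field_simp
  rw [Real.sq_sqrt hs'.le]
  ring

/-- The component `y_x` of `y` parallel to `x`, with `y_x = y` if `x = 0`. -/
def parPart {n : ℕ} (x y : EuclideanSpace ℝ (Fin n)) : EuclideanSpace ℝ (Fin n) :=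
  if x = 0 then y else (inner ℝ x y / ‖x‖ ^ 2) • x

/-- The component `y_x' = y - y_x` of `y` orthogonal to `x`, with `y_x' = 0` if `x = 0`. -/
def perpPart {n : ℕ} (x y : EuclideanSpace ℝ (Fin n)) : EuclideanSpace ℝ (Fin n) :=
  y - parPart x y

/-- `K₁`, where `exp^*(-X)` is `exp(-c X)`. The same `c` is used at all occurrences of `exp^*` in
`K₁, …, K₄`; since `X ≥ 0` there, this is equivalent to allowing a different positive constant at
each occurrence (take the smallest one). -/
def ouK1 {n : ℕ} (c t : ℝ) (x y : EuclideanSpace ℝ (Fin n)) : ℝ :=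
  t / (t ^ 2 + ‖x - y‖ ^ 2) ^ (((n : ℝ) + 1) / 2) * Real.exp (-(c * (t * (1 + ‖x‖))))

open Classical in
/-- `K₂`, with `exp^*(-X)` read as `exp(-c X)`. -/
def ouK2 {n : ℕ} (c t : ℝ) (x y : EuclideanSpace ℝ (Fin n)) : ℝ :=
  if 1 < ‖x‖ ∧ 0 < inner ℝ x y ∧ ‖x‖ / 2 ≤ ‖parPart x y‖ ∧ ‖parPart x y‖ < ‖x‖ then
    t / ‖x‖ *
      (t ^ 2 + ‖x - parPart x y‖ / ‖x‖ + ‖perpPart x y‖ ^ 2) ^ (-(((n : ℝ) + 2) / 2)) *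
      Real.exp (-(c * ((t ^ 2 + ‖perpPart x y‖ ^ 2) * ‖x‖ / ‖x - parPart x y‖)))
  else 0

/-- `K₃`, with `exp^*(-X)` read as `exp(-c X)`. -/
def ouK3 {n : ℕ} (c t : ℝ) (_x y : EuclideanSpace ℝ (Fin n)) : ℝ :=
  min 1 t * Real.exp (-(c * ‖y‖ ^ 2))

open Classical in
/-- `K₄`, with `exp^*(-X)` read as `exp(-c X)`. -/
def ouK4 {n : ℕ} (c t : ℝ) (x y : EuclideanSpace ℝ (Fin n)) : ℝ :=
  if 0 < inner ℝ x y ∧ 1 < ‖parPart x y‖ ∧ ‖parPart x y‖ < ‖x‖ / 2 then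
    t / ‖parPart x y‖ * Real.log (‖x‖ / ‖parPart x y‖) ^ (-(3 / 2) : ℝ) *
      Real.exp (-(c * (t ^ 2 / Real.log (‖x‖ / ‖parPart x y‖)))) *
      Real.exp (-(c * ‖perpPart x y‖ ^ 2))
  else 0

end

open MeasureTheory

/-! In the variable `s`, the Poisson kernel is a constant times the integral of `ouSubordinated`.
Applying `t ∂_t` or `t ∂_{x_i}` to this integrand only produces factors polynomial in `t / √s` and
`|y - e^{-s} x| / √(1 - e^{-2s})`. Part of the exponentials absorbs them, so both derivatives are at
most `4 * ouMajorant` with `a = 1/8`, and it remains to integrate the majorant.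

Put `X = |x|`, let `η` be the signed length of `y_x`, and `p = |y_x'|²`. Then `E = |y - e^{-s} x|² =
(η - e^{-s} X)² + p`. For `X > 0` the square can vanish at some `s > 0` only if `0 < η < X`, and
then at `σ = log (X / η)`. For `s ≤ 2` without cancellation, `E / s` controls `|x - y|² / s + s X²`
up to a constant. With `t² / s + s X² ≥ 2 t X`, integration in `s` gives `K₁`. For `s ≥ 1/4` without
cancellation, `E` controls `|y|²` up to a constant, which gives `K₃`. For `s` comparable to `σ`, the
majorant is at most a Gaussian in `s - σ`. If `X / 2 ≤ η < X`, its width is of order `√h / X` with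
`h = (X - η) / X` comparable to `σ`, which gives `K₂`. If `1 < η < X / 2`, its width is of order `1
/ η`, which gives `K₄`.

The case analysis is `exists_ouMajorant_le_densities`, pointwise in `s`; integrating the four
densities yields `exists_integral_ouMajorant_le`. The majorant with `E = 0` does not involve `x` and
`y` and also justifies differentiation under the integral. -/

/-- A common majorant of the scaled derivatives of the integrand of the Ornstein-Uhlenbeck Poisson
kernel, where `E` stands for `‖y - e^{-s} x‖²`. -/
noncomputable def ouMajorant (n : ℕ) (a t E s : ℝ) : ℝ :=
  t / s ^ (3 / 2 : ℝ) * Real.exp (-(a * (t ^ 2 / s))) *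
    (Real.exp (-(a * (E / (1 - Real.exp (-(2 * s)))))) /
      (1 - Real.exp (-(2 * s))) ^ ((n : ℝ) / 2))

/-! ### Elementary exponential inequalities. -/

/-- `v / (1 + v) ≤ 1 - e^{-v}`. -/
theorem div_one_add_le_one_sub_exp_neg {v : ℝ} (hv : 0 ≤ v) :
    v / (1 + v) ≤ 1 - Real.exp (-v) := by
  have h1 : Real.exp (-v) ≤ 1 / (1 + v) := by
    rw [Real.exp_neg, ← one_div]
    exact one_div_le_one_div_of_le (by linarith) (by linarith [Real.add_one_le_exp v])
  have h2 : v / (1 + v) = 1 - 1 / (1 + v) := by field_simp; ring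
  linarith

theorem one_sub_exp_neg_le (v : ℝ) : 1 - Real.exp (-v) ≤ v := by
  linarith [Real.add_one_le_exp (-v)]

/-- The linear bound `1 + δ v ≤ e^{δ v}` raised to the power `k` suffices as soon as `δ k ≤ β`. -/
theorem exists_one_add_rpow_le_exp {k β : ℝ} (hk : 0 ≤ k) (hβ : 0 < β) :
    ∃ C : ℝ, 0 < C ∧ ∀ v : ℝ, 0 ≤ v → (1 + v) ^ k ≤ C * Real.exp (β * v) := by
  -- The denominator `k + 1` rather than `k` covers `k = 0`.
  obtain ⟨δ, hδ⟩ : ∃ δ : ℝ, δ = β / (k + 1) := ⟨_, rfl⟩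
  have hδ0 : 0 < δ := by rw [hδ]; positivity
  have hδk : δ * k ≤ β := by
    rw [hδ, div_mul_eq_mul_div, div_le_iff₀ (by positivity)]; nlinarith
  refine ⟨(1 + 1 / δ) ^ k, by positivity, fun v hv => ?_⟩
  have h1 : 1 + v ≤ (1 + 1 / δ) * Real.exp (δ * v) := by
    have h2 := Real.add_one_le_exp (δ * v)
    have h3 : (1 + 1 / δ) * (δ * v + 1) = 1 + v + (δ * v + 1 / δ) := by field_simp; ring
    have h4 : 0 ≤ δ * v + 1 / δ := by positivity
    nlinarith [mul_le_mul_of_nonneg_left h2 (by positivity : 0 ≤ 1 + 1 / δ)]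
  calc (1 + v) ^ k ≤ ((1 + 1 / δ) * Real.exp (δ * v)) ^ k :=
        Real.rpow_le_rpow (by linarith) h1 hk
    _ = (1 + 1 / δ) ^ k * Real.exp (δ * v * k) := by
        rw [Real.mul_rpow (by positivity) (Real.exp_pos _).le, ← Real.exp_mul]
    _ ≤ _ := by
        refine mul_le_mul_of_nonneg_left (Real.exp_le_exp.2 ?_) (by positivity)
        nlinarith [mul_le_mul_of_nonneg_right hδk hv]

/-- A negative power of `s` damped by `e^{-β D / s}` is controlled by the same power of `s + D`. -/
theorem exists_rpow_neg_mul_exp_le {k β : ℝ} (hk : 0 ≤ k) (hβ : 0 < β) :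
    ∃ C : ℝ, 0 < C ∧ ∀ s D : ℝ, 0 < s → 0 ≤ D →
      s ^ (-k) * Real.exp (-(β * (D / s))) ≤ C * (s + D) ^ (-k) := by
  obtain ⟨C, hC, h⟩ := exists_one_add_rpow_le_exp hk hβ
  refine ⟨C, hC, fun s D hs hD => ?_⟩
  have h1 := h (D / s) (by positivity)
  have h2 : s + D = s * (1 + D / s) := by field_simp
  have h3 : 0 < 1 + D / s := by positivity
  rw [h2, Real.mul_rpow hs.le h3.le, Real.rpow_neg h3.le, Real.exp_neg]
  have h4 : (Real.exp (β * (D / s)))⁻¹ ≤ C * ((1 + D / s) ^ k)⁻¹ := by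
    rw [← div_eq_mul_inv, inv_le_comm₀ (Real.exp_pos _) (by positivity), inv_div,
      div_le_iff₀ hC]
    linarith
  calc _ ≤ s ^ (-k) * (C * ((1 + D / s) ^ k)⁻¹) := by gcongr
    _ = _ := by ring

theorem one_sub_exp_neg_two_mul_pos {s : ℝ} (hs : 0 < s) : 0 < 1 - Real.exp (-(2 * s)) := by
  have : Real.exp (-(2 * s)) < 1 := by
    rw [← Real.exp_zero]; exact Real.exp_lt_exp.2 (by linarith)
  linarith

theorem ouMajorant_nonneg {n : ℕ} {a t E s : ℝ} (ht : 0 ≤ t) (hs : 0 < s) :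
    0 ≤ ouMajorant n a t E s := by
  have := one_sub_exp_neg_two_mul_pos hs
  unfold ouMajorant
  positivity

/-! ### Bounds for the majorant in each regime of `s`. -/

/-- The majorant for bounded `s`. -/
theorem ouMajorant_le_of_le_two {n : ℕ} {a t E s : ℝ} (ha : 0 < a) (ht : 0 < t) (hE : 0 ≤ E)
    (hs : 0 < s) (hs2 : s ≤ 2) :
    ouMajorant n a t E s ≤ (5 / 2) ^ ((n : ℝ) / 2) *
      (t * (s ^ (-(((n : ℝ) + 3) / 2)) * Real.exp (-(a * (t ^ 2 / s + E / (2 * s)))))) := by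
  have h0 := one_sub_exp_neg_two_mul_pos hs
  have h1 : 1 - Real.exp (-(2 * s)) ≤ 2 * s := one_sub_exp_neg_le _
  -- With `v = 2 s ≤ 4`, the quotient `v / (1 + v)` is at least `2 s / 5`.
  have h2 : (5 / 2)⁻¹ * s ≤ 1 - Real.exp (-(2 * s)) := by
    refine le_trans ?_ (div_one_add_le_one_sub_exp_neg (by positivity))
    rw [le_div_iff₀ (by positivity)]
    nlinarith
  have h3 : E / (2 * s) ≤ E / (1 - Real.exp (-(2 * s))) :=
    div_le_div_of_nonneg_left hE h0 h1
  have h4 : ((1 - Real.exp (-(2 * s))) ^ ((n : ℝ) / 2))⁻¹ ≤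
      (5 / 2) ^ ((n : ℝ) / 2) * s ^ (-((n : ℝ) / 2)) := by
    rw [Real.rpow_neg hs.le, ← inv_inv ((5 / 2 : ℝ) ^ ((n : ℝ) / 2)), ← mul_inv,
      ← Real.inv_rpow (by norm_num : (0 : ℝ) ≤ 5 / 2), ← Real.mul_rpow (by norm_num) hs.le]
    exact inv_anti₀ (by positivity) (Real.rpow_le_rpow (by positivity) h2 (by positivity))
  have h5 : s ^ (-(((n : ℝ) + 3) / 2)) = (s ^ (3 / 2 : ℝ))⁻¹ * s ^ (-((n : ℝ) / 2)) := by
    rw [← Real.rpow_neg hs.le, ← Real.rpow_add hs]; congr 1; ring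
  have h6 : Real.exp (-(a * (t ^ 2 / s + E / (2 * s)))) =
      Real.exp (-(a * (t ^ 2 / s))) * Real.exp (-(a * (E / (2 * s)))) := by
    rw [← Real.exp_add]; congr 1; ring
  calc ouMajorant n a t E s = t * (s ^ (3 / 2 : ℝ))⁻¹ * Real.exp (-(a * (t ^ 2 / s))) *
        (Real.exp (-(a * (E / (1 - Real.exp (-(2 * s)))))) *
          ((1 - Real.exp (-(2 * s))) ^ ((n : ℝ) / 2))⁻¹) := by
        unfold ouMajorant; simp only [div_eq_mul_inv]
    _ ≤ t * (s ^ (3 / 2 : ℝ))⁻¹ * Real.exp (-(a * (t ^ 2 / s))) *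
        (Real.exp (-(a * (E / (2 * s)))) *
          ((5 / 2) ^ ((n : ℝ) / 2) * s ^ (-((n : ℝ) / 2)))) := by gcongr
    _ = _ := by rw [h5, h6]; ring

/-- The majorant for `s` bounded below. -/
theorem ouMajorant_le_of_le {n : ℕ} {a t E s : ℝ} (ha : 0 < a) (ht : 0 < t) (hE : 0 ≤ E)
    (hs : 1 / 4 ≤ s) :
    ouMajorant n a t E s ≤ 3 ^ ((n : ℝ) / 2) *
      (t * (s ^ (-(3 / 2 : ℝ)) * Real.exp (-(a * (t ^ 2 / s + E))))) := by
  have hs0 : 0 < s := by linarith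
  have h0 := one_sub_exp_neg_two_mul_pos hs0
  have h1 : 1 - Real.exp (-(2 * s)) ≤ 1 := by linarith [Real.exp_pos (-(2 * s))]
  have h2 : 3⁻¹ ≤ 1 - Real.exp (-(2 * s)) := by
    refine le_trans ?_ (div_one_add_le_one_sub_exp_neg (by positivity))
    rw [le_div_iff₀ (by positivity)]
    linarith
  have h3 : E ≤ E / (1 - Real.exp (-(2 * s))) := le_div_self hE h0 h1
  have h4 : ((1 - Real.exp (-(2 * s))) ^ ((n : ℝ) / 2))⁻¹ ≤ 3 ^ ((n : ℝ) / 2) := by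
    rw [← inv_inv ((3 : ℝ) ^ ((n : ℝ) / 2)), ← Real.inv_rpow (by norm_num : (0 : ℝ) ≤ 3)]
    exact inv_anti₀ (by positivity) (Real.rpow_le_rpow (by positivity) h2 (by positivity))
  have h6 : Real.exp (-(a * (t ^ 2 / s + E))) =
      Real.exp (-(a * (t ^ 2 / s))) * Real.exp (-(a * E)) := by
    rw [← Real.exp_add]; congr 1; ring
  calc ouMajorant n a t E s = t * (s ^ (3 / 2 : ℝ))⁻¹ * Real.exp (-(a * (t ^ 2 / s))) *
        (Real.exp (-(a * (E / (1 - Real.exp (-(2 * s)))))) *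
          ((1 - Real.exp (-(2 * s))) ^ ((n : ℝ) / 2))⁻¹) := by
        unfold ouMajorant; simp only [div_eq_mul_inv]
    _ ≤ t * (s ^ (3 / 2 : ℝ))⁻¹ * Real.exp (-(a * (t ^ 2 / s))) *
        (Real.exp (-(a * E)) * 3 ^ ((n : ℝ) / 2)) := by gcongr
    _ = _ := by rw [h6, Real.rpow_neg hs0.le]; ring

/-- The regime of small `s` in which the majorant is bounded by a `K₁`-type density. -/
theorem exists_ouMajorant_le_local (n : ℕ) {a κ : ℝ} (ha : 0 < a) (hκ : 0 < κ) (hκ1 : κ ≤ 1)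
    (l : ℝ) :
    ∃ C : ℝ, 0 < C ∧ ∀ t D X E s : ℝ, 0 < t → 0 ≤ D → 0 ≤ E → 0 < s → s ≤ 2 →
      κ * (D / s + s * X ^ 2) - l ≤ E / (2 * s) →
      ouMajorant n a t E s ≤ C * (t * (s + (t ^ 2 + D)) ^ (-(((n : ℝ) + 3) / 2)) *
        Real.exp (-(a * κ / 4 * (t * (1 + X))))) := by
  obtain ⟨C, hC, h⟩ := exists_rpow_neg_mul_exp_le (k := ((n : ℝ) + 3) / 2) (β := a * κ / 2)
    (by positivity) (by positivity)
  refine ⟨(5 / 2) ^ ((n : ℝ) / 2) * (Real.exp (a * (l + 1)) * C), by positivity, ?_⟩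
  intro t D X E s ht hD hE hs hs2 hexp
  refine (ouMajorant_le_of_le_two ha ht hE hs hs2).trans ?_
  -- The decay in `t X` comes from `t² / s + s X² ≥ 2 t X`, the decay in `t` from `t² / s ≥ t² / 2 ≥
  -- t - 1/2`. Enough of the exponent is left to replace `s` by `s + t² + D` in the negative power.
  have h1 : κ / 2 * ((t ^ 2 + D) / s) + κ / 4 * (t * (1 + X)) - (l + 1) ≤
      t ^ 2 / s + E / (2 * s) := by
    have e1 : 2 * (t * X) ≤ t ^ 2 / s + s * X ^ 2 := by
      have : t ^ 2 / s + s * X ^ 2 - 2 * (t * X) = (t - s * X) ^ 2 / s := by field_simp; ring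
      have : 0 ≤ (t - s * X) ^ 2 / s := by positivity
      linarith
    have e2 : t - 1 / 2 ≤ t ^ 2 / s := by
      have : t ^ 2 / 2 ≤ t ^ 2 / s := div_le_div_of_nonneg_left (by positivity) hs hs2
      nlinarith [sq_nonneg (t - 1)]
    have e3 : (0 : ℝ) ≤ s * X ^ 2 := by positivity
    have e4 : (t ^ 2 + D) / s = t ^ 2 / s + D / s := add_div _ _ _
    have e5 : κ * (t ^ 2 / s) ≤ t ^ 2 / s := mul_le_of_le_one_left (by positivity) hκ1
    have e6 : 0 ≤ D / s := by positivity
    have e9 : 0 ≤ t ^ 2 / s := by positivity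
    have e7 : κ / 4 * (t * (1 + X)) ≤ κ / 4 * (2 * (t ^ 2 / s + s * X ^ 2) + 1 / 2) :=
      mul_le_mul_of_nonneg_left (by nlinarith) (by positivity)
    have e8 : 0 ≤ κ * (D / s) := by positivity
    rw [e4]
    nlinarith
  have h2 : Real.exp (-(a * (t ^ 2 / s + E / (2 * s)))) ≤
      Real.exp (a * (l + 1)) * Real.exp (-(a * κ / 2 * ((t ^ 2 + D) / s))) *
        Real.exp (-(a * κ / 4 * (t * (1 + X)))) := by
    rw [← Real.exp_add, ← Real.exp_add]
    apply Real.exp_le_exp.2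
    have := mul_le_mul_of_nonneg_left h1 ha.le
    linarith
  have h3 := h s (t ^ 2 + D) hs (by positivity)
  calc _ ≤ (5 / 2) ^ ((n : ℝ) / 2) * (t * (s ^ (-(((n : ℝ) + 3) / 2)) *
        (Real.exp (a * (l + 1)) * Real.exp (-(a * κ / 2 * ((t ^ 2 + D) / s))) *
        Real.exp (-(a * κ / 4 * (t * (1 + X))))))) := by gcongr
    _ = (5 / 2) ^ ((n : ℝ) / 2) * Real.exp (a * (l + 1)) * t *
        Real.exp (-(a * κ / 4 * (t * (1 + X)))) * (s ^ (-(((n : ℝ) + 3) / 2)) *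
        Real.exp (-(a * κ / 2 * ((t ^ 2 + D) / s)))) := by ring
    _ ≤ (5 / 2) ^ ((n : ℝ) / 2) * Real.exp (a * (l + 1)) * t *
        Real.exp (-(a * κ / 4 * (t * (1 + X)))) * (C * (s + (t ^ 2 + D)) ^
          (-(((n : ℝ) + 3) / 2))) := by gcongr
    _ = _ := by ring

/-- The regime of large `s` in which the majorant is bounded by a `K₃`-type density. -/
theorem exists_ouMajorant_le_global (n : ℕ) {a : ℝ} (ha : 0 < a) (κ l : ℝ) :
    ∃ C : ℝ, 0 < C ∧ ∀ t Y E s : ℝ, 0 < t → 0 ≤ E → 1 / 4 ≤ s →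
      κ * Y ^ 2 - l ≤ E →
      ouMajorant n a t E s ≤ C * (t * (s + (t ^ 2 + 1)) ^ (-(3 / 2 : ℝ)) *
        Real.exp (-(a * κ * Y ^ 2))) := by
  obtain ⟨C, hC, h⟩ := exists_rpow_neg_mul_exp_le (k := (3 / 2 : ℝ)) (β := a)
    (by positivity) ha
  refine ⟨3 ^ ((n : ℝ) / 2) * (Real.exp (a * (l + 4)) * C), by positivity, ?_⟩
  intro t Y E s ht hE hs hexp
  have hs0 : 0 < s := by linarith
  refine (ouMajorant_le_of_le ha ht hE hs).trans ?_
  -- Since `1 / s ≤ 4`, inserting `e^{-a / s}` costs only a constant. It turns `t²` into `t² + 1`,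
  -- so the density stays integrable down to `s = 0` uniformly in `t`.
  have h2 : Real.exp (-(a * (t ^ 2 / s + E))) ≤
      Real.exp (a * (l + 4)) * Real.exp (-(a * ((t ^ 2 + 1) / s))) *
        Real.exp (-(a * κ * Y ^ 2)) := by
    rw [← Real.exp_add, ← Real.exp_add]
    apply Real.exp_le_exp.2
    have e1 : (t ^ 2 + 1) / s = t ^ 2 / s + 1 / s := add_div _ _ _
    have e2 : 1 / s ≤ 4 := by rw [div_le_iff₀ hs0]; linarith
    have := mul_le_mul_of_nonneg_left hexp ha.le
    have := mul_le_mul_of_nonneg_left e2 ha.le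
    rw [e1]
    linarith
  have h3 := h s (t ^ 2 + 1) hs0 (by positivity)
  calc _ ≤ 3 ^ ((n : ℝ) / 2) * (t * (s ^ (-(3 / 2 : ℝ)) *
        (Real.exp (a * (l + 4)) * Real.exp (-(a * ((t ^ 2 + 1) / s))) *
        Real.exp (-(a * κ * Y ^ 2))))) := by gcongr
    _ = 3 ^ ((n : ℝ) / 2) * Real.exp (a * (l + 4)) * t *
        Real.exp (-(a * κ * Y ^ 2)) * (s ^ (-(3 / 2 : ℝ)) *
        Real.exp (-(a * ((t ^ 2 + 1) / s)))) := by ring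
    _ ≤ 3 ^ ((n : ℝ) / 2) * Real.exp (a * (l + 4)) * t *
        Real.exp (-(a * κ * Y ^ 2)) * (C * (s + (t ^ 2 + 1)) ^ (-(3 / 2 : ℝ))) := by gcongr
    _ = _ := by ring

/-- The regime where `s` is comparable to a small number `h`. -/
theorem ouMajorant_le_peak_local {n : ℕ} {a b t p W E s h : ℝ} (ha : 0 < a) (hb : 0 < b)
    (hba : 16 * b ≤ a) (ht : 0 < t)
    (hp : 0 ≤ p) (hW : 0 ≤ W) (hE : W + p ≤ E) (hs : 0 < s) (hs2 : s ≤ 2) (hh : 0 < h)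
    (hhs : h ≤ 2 * s) (hsh : s ≤ 4 * h) :
    ouMajorant n a t E s ≤ 5 ^ (((n : ℝ) + 3) / 2) * (t * h ^ (-(((n : ℝ) + 3) / 2)) *
      Real.exp (-(2 * b * ((t ^ 2 + p) / h))) * Real.exp (-(2 * b * (W / h)))) := by
  have hE0 : 0 ≤ E := by linarith
  refine (ouMajorant_le_of_le_two ha ht hE0 hs hs2).trans ?_
  have h1 : s ^ (-(((n : ℝ) + 3) / 2)) ≤ 2 ^ (((n : ℝ) + 3) / 2) *
      h ^ (-(((n : ℝ) + 3) / 2)) := by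
    have e1 : (2⁻¹ * h) ^ (-(((n : ℝ) + 3) / 2)) = 2 ^ (((n : ℝ) + 3) / 2) *
        h ^ (-(((n : ℝ) + 3) / 2)) := by
      rw [Real.mul_rpow (by norm_num) hh.le, Real.inv_rpow (by norm_num),
        Real.rpow_neg (by norm_num), inv_inv]
    rw [← e1]
    refine Real.rpow_le_rpow_of_nonpos (by positivity) (by linarith) ?_
    have : 0 ≤ ((n : ℝ) + 3) / 2 := by positivity
    linarith
  have h2 : (5 / 2 : ℝ) ^ ((n : ℝ) / 2) ≤ (5 / 2) ^ (((n : ℝ) + 3) / 2) :=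
    Real.rpow_le_rpow_of_exponent_le (by norm_num) (by linarith)
  have h3 : (5 / 2 : ℝ) ^ (((n : ℝ) + 3) / 2) * 2 ^ (((n : ℝ) + 3) / 2) =
      5 ^ (((n : ℝ) + 3) / 2) := by
    rw [← Real.mul_rpow (by norm_num) (by norm_num)]; norm_num
  have h4 : Real.exp (-(a * (t ^ 2 / s + E / (2 * s)))) ≤
      Real.exp (-(2 * b * ((t ^ 2 + p) / h))) * Real.exp (-(2 * b * (W / h))) := by
    rw [← Real.exp_add]
    apply Real.exp_le_exp.2
    -- Here `s ≤ 4 h` enters as `2 s ≤ 8 h`; together with the factor `2 b` this accounts for `16 b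
    -- ≤ a`.
    have e1 : (t ^ 2 + p + W) / (8 * h) ≤ (2 * t ^ 2 + E) / (2 * s) := by
      rw [div_le_div_iff₀ (by positivity) (by positivity)]
      nlinarith [mul_le_mul (by nlinarith [sq_nonneg t] : t ^ 2 + p + W ≤ 2 * t ^ 2 + E)
        (by linarith : 2 * s ≤ 8 * h) (by positivity) (by positivity)]
    have e2 : (2 * t ^ 2 + E) / (2 * s) = t ^ 2 / s + E / (2 * s) := by field_simp
    have e3 : 2 * b * ((t ^ 2 + p) / h) + 2 * b * (W / h) =
        16 * b * ((t ^ 2 + p + W) / (8 * h)) := by field_simp; ring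
    have e4 : 0 ≤ (t ^ 2 + p + W) / (8 * h) := by positivity
    rw [e2] at e1
    have := mul_le_mul hba e1 e4 ha.le
    linarith
  calc _ ≤ (5 / 2 : ℝ) ^ (((n : ℝ) + 3) / 2) * (t * ((2 ^ (((n : ℝ) + 3) / 2) *
      h ^ (-(((n : ℝ) + 3) / 2))) * (Real.exp (-(2 * b * ((t ^ 2 + p) / h))) *
        Real.exp (-(2 * b * (W / h)))))) := by gcongr
    _ = _ := by rw [← h3]; ring

/-- The regime where `s` is comparable to a number `σ ≥ 1/2`. -/
theorem ouMajorant_le_peak_global {n : ℕ} {a b t E F s σ : ℝ} (ha : 0 < a)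
    (hba : 2 * b ≤ a) (ht : 0 < t) (hF : 0 ≤ F) (hE : F ≤ E) (hs : 1 / 4 ≤ s) (hσ : 0 < σ)
    (hσs : σ ≤ 2 * s) (hsσ : s ≤ 2 * σ) :
    ouMajorant n a t E s ≤ 3 ^ ((n : ℝ) / 2) * 2 ^ (3 / 2 : ℝ) * (t * σ ^ (-(3 / 2) : ℝ) *
      Real.exp (-(b * (t ^ 2 / σ))) * Real.exp (-(b * F))) := by
  have hs0 : 0 < s := by linarith
  refine (ouMajorant_le_of_le ha ht (hF.trans hE) hs).trans ?_
  have h1 : s ^ (-(3 / 2) : ℝ) ≤ 2 ^ (3 / 2 : ℝ) * σ ^ (-(3 / 2) : ℝ) := by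
    have e1 : (2⁻¹ * σ) ^ (-(3 / 2) : ℝ) = 2 ^ (3 / 2 : ℝ) * σ ^ (-(3 / 2) : ℝ) := by
      rw [Real.mul_rpow (by norm_num) hσ.le, Real.inv_rpow (by norm_num),
        Real.rpow_neg (by norm_num), inv_inv]
    rw [← e1]
    exact Real.rpow_le_rpow_of_nonpos (by positivity) (by linarith) (by norm_num)
  have h4 : Real.exp (-(a * (t ^ 2 / s + E))) ≤
      Real.exp (-(b * (t ^ 2 / σ))) * Real.exp (-(b * F)) := by
    rw [← Real.exp_add]
    apply Real.exp_le_exp.2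
    have e1 : t ^ 2 / σ ≤ 2 * (t ^ 2 / s) := by
      rw [← mul_div_assoc, div_le_div_iff₀ hσ hs0]
      nlinarith [sq_nonneg t]
    have e2 : 0 ≤ t ^ 2 / σ := by positivity
    have e3 := mul_le_mul_of_nonneg_right hba e2
    have e4 := mul_le_mul_of_nonneg_right hba hF
    have e5 := mul_le_mul_of_nonneg_left e1 ha.le
    have e6 := mul_le_mul_of_nonneg_left hE ha.le
    have e7 := mul_nonneg ha.le hF
    linarith
  calc _ ≤ 3 ^ ((n : ℝ) / 2) * (t * ((2 ^ (3 / 2 : ℝ) * σ ^ (-(3 / 2) : ℝ)) *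
      (Real.exp (-(b * (t ^ 2 / σ))) * Real.exp (-(b * F))))) := by gcongr
    _ = _ := by ring

/-! ### The four densities. -/

/-- The density (in the variable `s`) whose integral gives `K₁`. Here and below `X = ‖x‖`, the
number `η` is the signed length of `y_x`, and `p = ‖y_x'‖²`. -/
noncomputable def ouDensity₁ (n : ℕ) (c t X η p s : ℝ) : ℝ :=
  t * (s + (t ^ 2 + ((X - η) ^ 2 + p))) ^ (-(((n : ℝ) + 3) / 2)) *
    Real.exp (-(c * (t * (1 + X))))

open Classical in
/-- The density whose integral gives `K₂`. -/
noncomputable def ouDensity₂ (n : ℕ) (c t X η p s : ℝ) : ℝ :=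
  if 1 < X ∧ X / 2 ≤ η ∧ η < X then
    t * ((X - η) / X) ^ (-(((n : ℝ) + 3) / 2)) *
      Real.exp (-(2 * c * ((t ^ 2 + p) / ((X - η) / X)))) *
      Real.exp (-(2 * c * (X ^ 2 * (s - Real.log (X / η)) ^ 2 / 81 / ((X - η) / X))))
  else 0

/-- The density whose integral gives `K₃`. -/
noncomputable def ouDensity₃ (c t η p s : ℝ) : ℝ :=
  t * (s + (t ^ 2 + 1)) ^ (-(3 / 2 : ℝ)) * Real.exp (-(c * (η ^ 2 + p)))

open Classical in
/-- The density whose integral gives `K₄`. -/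
noncomputable def ouDensity₄ (c t X η p s : ℝ) : ℝ :=
  if 1 < η ∧ η < X / 2 then
    t * Real.log (X / η) ^ (-(3 / 2) : ℝ) * Real.exp (-(c * (t ^ 2 / Real.log (X / η)))) *
      Real.exp (-(c * (η ^ 2 * (s - Real.log (X / η)) ^ 2 / 4 + p)))
  else 0

theorem ouDensity₁_nonneg {n : ℕ} {c t X η p s : ℝ} (ht : 0 ≤ t) (hp : 0 ≤ p) (hs : 0 ≤ s) :
    0 ≤ ouDensity₁ n c t X η p s := by
  unfold ouDensity₁; positivity

theorem ouDensity₂_nonneg {n : ℕ} {c t X η p s : ℝ} (ht : 0 ≤ t) :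
    0 ≤ ouDensity₂ n c t X η p s := by
  unfold ouDensity₂
  split_ifs with h
  · have : 0 < X - η := by linarith
    have : 0 < X := by linarith
    positivity
  · exact le_rfl

theorem ouDensity₃_nonneg {c t η p s : ℝ} (ht : 0 ≤ t) (hs : 0 ≤ s) :
    0 ≤ ouDensity₃ c t η p s := by
  unfold ouDensity₃; positivity

theorem log_div_pos {X η : ℝ} (hη : 0 < η) (h : η < X) : 0 < Real.log (X / η) :=
  Real.log_pos ((one_lt_div hη).2 h)

theorem ouDensity₄_nonneg {c t X η p s : ℝ} (ht : 0 ≤ t) : 0 ≤ ouDensity₄ c t X η p s := by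
  unfold ouDensity₄
  split_ifs with h
  · have : 0 < Real.log (X / η) := log_div_pos (by linarith) (by linarith)
    positivity
  · exact le_rfl

/-- This clears denominators in the hypothesis of `exists_ouMajorant_le_local` with `κ = 1/2000` and
`l = 2`; the slack `4 s` is `l` multiplied by `2 s`. -/
theorem local_condition_of_le {D E X s : ℝ} (hs : 0 < s)
    (h : D + s ^ 2 * X ^ 2 ≤ 1000 * (E + 4 * s)) :
    1 / 2000 * (D / s + s * X ^ 2) - 2 ≤ E / (2 * s) := by
  rw [le_div_iff₀ (by positivity)]
  have : (1 / 2000 * (D / s + s * X ^ 2) - 2) * (2 * s) =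
      1 / 1000 * (D + s ^ 2 * X ^ 2) - 4 * s := by field_simp; ring
  linarith

theorem exp_neg_ge_of_le_two {s : ℝ} (hs : s ≤ 2) : 1 / 9 ≤ Real.exp (-s) := by
  have h1 : Real.exp (-2) ≤ Real.exp (-s) := Real.exp_le_exp.2 (by linarith)
  have h2 : Real.exp 2 ≤ 9 := by
    have : Real.exp 2 = Real.exp 1 * Real.exp 1 := by rw [← Real.exp_add]; norm_num
    rw [this]
    nlinarith [Real.exp_one_lt_d9, Real.exp_pos 1]
  have h3 : 1 / 9 ≤ Real.exp (-2) := by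
    rw [Real.exp_neg, ← one_div]
    exact one_div_le_one_div_of_le (Real.exp_pos 2) h2
  linarith

theorem exp_neg_le_of_two_le {s : ℝ} (hs : 2 ≤ s) : Real.exp (-s) ≤ 1 / 3 := by
  rw [Real.exp_neg, ← one_div]
  exact one_div_le_one_div_of_le (by norm_num) (by linarith [Real.add_one_le_exp s])

theorem div_three_le_one_sub_exp_neg {s : ℝ} (hs : 0 ≤ s) (hs2 : s ≤ 2) :
    s / 3 ≤ 1 - Real.exp (-s) := by
  refine le_trans ?_ (div_one_add_le_one_sub_exp_neg hs)
  exact div_le_div_of_nonneg_left hs (by linarith) (by linarith)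

/-- A lower Lipschitz bound for `e^{-s}` on `(-∞, 2]`. -/
theorem sq_sub_le_sq_exp_neg_sub {s σ : ℝ} (hs : s ≤ 2) (hσ : σ ≤ 2) :
    (s - σ) ^ 2 ≤ 81 * (Real.exp (-σ) - Real.exp (-s)) ^ 2 := by
  wlog h : σ ≤ s generalizing s σ
  · have := this hσ hs (by linarith)
    nlinarith
  have h1 : Real.exp (-σ) = Real.exp (-s) * Real.exp (s - σ) := by
    rw [← Real.exp_add]; congr 1; ring
  have h2 := Real.add_one_le_exp (s - σ)
  have h3 := exp_neg_ge_of_le_two hs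
  -- The difference is `e^{-s} (e^{s - σ} - 1)`, with `e^{-s} ≥ 1/9` and `e^{s - σ} - 1 ≥ s - σ`.
  have h4 : s - σ ≤ 9 * (Real.exp (-σ) - Real.exp (-s)) := by
    rw [h1]
    nlinarith [mul_le_mul_of_nonneg_left h2 (Real.exp_pos (-s)).le]
  nlinarith

/-- Near `0` the function `1 - e^{-v}` is comparable to `v`; away from `0` its modulus is bounded
below. With `v = s - σ`, this separates the peak at `σ` from the rest. -/
theorem sq_le_sq_one_sub_exp_neg {v : ℝ} (hv : |v| ≤ 1 / 4) :
    v ^ 2 ≤ 4 * (1 - Real.exp (-v)) ^ 2 := by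
  obtain ⟨h1, h2⟩ := abs_le.1 hv
  rcases le_total 0 v with h | h
  · have h3 : v / 2 ≤ 1 - Real.exp (-v) := by
      refine le_trans ?_ (div_one_add_le_one_sub_exp_neg h)
      exact div_le_div_of_nonneg_left h (by linarith) (by linarith)
    nlinarith
  · have h3 := one_sub_exp_neg_le v
    nlinarith

theorem one_le_sq_one_sub_exp_neg {v : ℝ} (hv : 1 / 4 ≤ |v|) :
    1 ≤ 25 * (1 - Real.exp (-v)) ^ 2 := by
  rcases le_abs.1 hv with h | h
  · have h3 : 1 / 5 ≤ 1 - Real.exp (-v) := by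
      refine le_trans ?_ (div_one_add_le_one_sub_exp_neg (by linarith))
      rw [le_div_iff₀ (by linarith)]; linarith
    nlinarith
  · have h3 := one_sub_exp_neg_le v
    nlinarith

/-! ### Lower bounds for `(η - e^{-s} X)² + p`, region by region. -/

section Regimes

variable {X η p s : ℝ}

/-- For `X ≤ 1` the shift `(1 - e^{-s}) X` and the term `s X` are both at most `s`, and `s² ≤ 2 s`
lets the slack `4 s` absorb their squares. -/
theorem local_of_le_one (hX : 0 ≤ X) (hp : 0 ≤ p) (hX1 : X ≤ 1) (hs : 0 < s) (hs2 : s ≤ 2) :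
    ((X - η) ^ 2 + p) + s ^ 2 * X ^ 2 ≤ 1000 * (((η - Real.exp (-s) * X) ^ 2 + p) + 4 * s) := by
  have h1 := one_sub_exp_neg_le s
  have h2 : 0 ≤ 1 - Real.exp (-s) := by
    linarith [div_three_le_one_sub_exp_neg hs.le hs2, hs]
  obtain ⟨v, hv⟩ : ∃ v, v = (1 - Real.exp (-s)) * X := ⟨_, rfl⟩
  have h3 : 0 ≤ v := by rw [hv]; positivity
  have h4 : v ≤ s := by rw [hv]; nlinarith
  have h5 : η - Real.exp (-s) * X = (η - X) + v := by rw [hv]; ring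
  have h6 : s ^ 2 * X ^ 2 ≤ s ^ 2 * 1 :=
    mul_le_mul_of_nonneg_left (by nlinarith) (sq_nonneg s)
  rw [h5]
  nlinarith [sq_nonneg ((η - X) + 2 * v)]

theorem global_of_le_one (hX : 0 ≤ X) (hp : 0 ≤ p) (hX1 : X ≤ 1) (hs2 : 2 ≤ s) :
    1 / 8000 * (η ^ 2 + p) - 2 ≤ (η - Real.exp (-s) * X) ^ 2 + p := by
  have h1 := exp_neg_le_of_two_le hs2
  have h2 := Real.exp_pos (-s)
  have h3 : 0 ≤ Real.exp (-s) * X := by positivity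
  have h4 : Real.exp (-s) * X ≤ 1 := by nlinarith
  nlinarith [sq_nonneg (η - 2 * (Real.exp (-s) * X))]

/-- The numbers `η - X` and `(1 - e^{-s}) X ≥ s X / 3` are both nonnegative, so their sum has no
cancellation. -/
theorem local_of_ge (hX : 0 ≤ X) (hp : 0 ≤ p) (h : X ≤ η) (hs : 0 < s) (hs2 : s ≤ 2) :
    ((X - η) ^ 2 + p) + s ^ 2 * X ^ 2 ≤ 1000 * (((η - Real.exp (-s) * X) ^ 2 + p) + 4 * s) := by
  have h2 := div_three_le_one_sub_exp_neg hs.le hs2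
  have h3 : s / 3 * X ≤ (1 - Real.exp (-s)) * X := mul_le_mul_of_nonneg_right h2 hX
  have h4 : (η - X) + s / 3 * X ≤ η - Real.exp (-s) * X := by linarith
  have h6 : 0 ≤ s * X := by positivity
  have h5 : ((η - X) + s / 3 * X) ^ 2 ≤ (η - Real.exp (-s) * X) ^ 2 :=
    pow_le_pow_left₀ (by nlinarith) h4 2
  have h7 : 0 ≤ (η - X) * (s * X) := mul_nonneg (by linarith) h6
  nlinarith [sq_nonneg (η - X), sq_nonneg (s * X)]

/-- Here `e^{-s} X ≤ X / 3 ≤ 2 η / 3`, so a third of `η` survives. -/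
theorem global_of_half_le (hX : 0 ≤ X) (hp : 0 ≤ p) (h : X / 2 ≤ η) (hs2 : 2 ≤ s) :
    1 / 8000 * (η ^ 2 + p) - 2 ≤ (η - Real.exp (-s) * X) ^ 2 + p := by
  have h1 := exp_neg_le_of_two_le hs2
  have h2 : Real.exp (-s) * X ≤ 1 / 3 * X := mul_le_mul_of_nonneg_right h1 hX
  have h3 : (η / 3) ^ 2 ≤ (η - Real.exp (-s) * X) ^ 2 :=
    pow_le_pow_left₀ (by linarith) (by linarith) 2
  nlinarith [sq_nonneg η]

/-- The points `η` and `e^{-s} X` lie on opposite sides of `0`, and `e^{-s} ≥ 1/9`, so their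
distance is at least `(X - η) / 9`. -/
theorem local_of_nonpos (hX : 0 ≤ X) (hp : 0 ≤ p) (h : η ≤ 0) (hs : 0 < s) (hs2 : s ≤ 2) :
    ((X - η) ^ 2 + p) + s ^ 2 * X ^ 2 ≤ 1000 * (((η - Real.exp (-s) * X) ^ 2 + p) + 4 * s) := by
  have h1 := exp_neg_ge_of_le_two hs2
  have h2 : 1 / 9 * X ≤ Real.exp (-s) * X := mul_le_mul_of_nonneg_right h1 hX
  have h3 : (1 / 9 * (X - η)) ^ 2 ≤ (Real.exp (-s) * X - η) ^ 2 :=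
    pow_le_pow_left₀ (by nlinarith) (by linarith) 2
  have h4 : X ^ 2 ≤ (X - η) ^ 2 := pow_le_pow_left₀ hX (by linarith) 2
  have h5 : s ^ 2 * X ^ 2 ≤ 4 * X ^ 2 :=
    mul_le_mul_of_nonneg_right (by nlinarith) (sq_nonneg X)
  nlinarith

theorem global_of_nonpos (hX : 0 ≤ X) (hp : 0 ≤ p) (h : η ≤ 0) :
    1 / 8000 * (η ^ 2 + p) - 2 ≤ (η - Real.exp (-s) * X) ^ 2 + p := by
  have h2 : 0 ≤ Real.exp (-s) * X := by positivity
  nlinarith [sq_nonneg η, mul_nonneg h2 (by linarith : 0 ≤ -η)]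

/-- For such small `s`, `e^{-s} X ≥ 3 X / 4` stays at distance at least `X / 4` from `η`. -/
theorem local_of_lt_half (hp : 0 ≤ p) (hη : 0 < η) (h : η < X / 2) (hs : 0 < s)
    (hs4 : s ≤ 1 / 4) :
    ((X - η) ^ 2 + p) + s ^ 2 * X ^ 2 ≤ 1000 * (((η - Real.exp (-s) * X) ^ 2 + p) + 4 * s) := by
  have h1 := one_sub_exp_neg_le s
  have h2 : 3 / 4 * X ≤ Real.exp (-s) * X := mul_le_mul_of_nonneg_right (by linarith) (by linarith)
  have h3 : (X / 4) ^ 2 ≤ (Real.exp (-s) * X - η) ^ 2 :=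
    pow_le_pow_left₀ (by linarith) (by linarith) 2
  have h4 : (X - η) ^ 2 ≤ X ^ 2 := pow_le_pow_left₀ (by linarith) (by linarith) 2
  have h5 : s ^ 2 * X ^ 2 ≤ 1 * X ^ 2 :=
    mul_le_mul_of_nonneg_right (by nlinarith) (sq_nonneg X)
  nlinarith

theorem global_of_abs_le_one (hp : 0 ≤ p) (hη : 0 < η) (h : η ≤ 1) :
    1 / 8000 * (η ^ 2 + p) - 2 ≤ (η - Real.exp (-s) * X) ^ 2 + p := by
  nlinarith [sq_nonneg (η - Real.exp (-s) * X)]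

/-- Substituting `X = η e^σ` with `σ = log (X / η)` makes the distance depend only on `η` and `s -
σ`. -/
theorem sub_exp_neg_mul_eq (hη : 0 < η) (hX : 0 < X) :
    η - Real.exp (-s) * X = η * (1 - Real.exp (-(s - Real.log (X / η)))) := by
  have : Real.exp (-(s - Real.log (X / η))) = Real.exp (-s) * (X / η) := by
    rw [← Real.exp_log (div_pos hX hη), ← Real.exp_add, Real.exp_log (div_pos hX hη)]
    congr 1; ring
  rw [this]; field_simp

theorem global_of_far (hp : 0 ≤ p) (hη : 0 < η) (hX : 0 < X)
    (h : 1 / 4 ≤ |s - Real.log (X / η)|) :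
    1 / 8000 * (η ^ 2 + p) - 2 ≤ (η - Real.exp (-s) * X) ^ 2 + p := by
  rw [sub_exp_neg_mul_eq hη hX]
  have := mul_le_mul_of_nonneg_left (one_le_sq_one_sub_exp_neg h) (sq_nonneg η)
  nlinarith

theorem peak_lower_bound (hη : 0 < η) (hX : 0 < X)
    (h : |s - Real.log (X / η)| ≤ 1 / 4) :
    η ^ 2 * (s - Real.log (X / η)) ^ 2 / 4 + p ≤ (η - Real.exp (-s) * X) ^ 2 + p := by
  rw [sub_exp_neg_mul_eq hη hX]
  have := mul_le_mul_of_nonneg_left (sq_le_sq_one_sub_exp_neg h) (sq_nonneg η)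
  nlinarith

theorem exp_neg_log_div (hη : 0 < η) (hX : 0 < X) : Real.exp (-Real.log (X / η)) = η / X := by
  rw [Real.exp_neg, Real.exp_log (div_pos hX hη), inv_div]

theorem log_div_le_one (hX : 0 < X) (h : X / 2 ≤ η) : Real.log (X / η) ≤ 1 := by
  have : X / η ≤ 2 := by rw [div_le_iff₀ (by linarith)]; linarith
  have h2 := Real.log_le_sub_one_of_pos (div_pos hX (by linarith : 0 < η))
  linarith

/-- Factoring out `X` instead of `η` leaves `e^{-σ} - e^{-s}`, whose lower Lipschitz bound needs
only `s, σ ≤ 2`, not closeness of `s` to `σ`. -/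
theorem peak_lower_bound_local (hX : 0 < X) (h : X / 2 ≤ η) (hs2 : s ≤ 2) :
    X ^ 2 * (s - Real.log (X / η)) ^ 2 / 81 + p ≤ (η - Real.exp (-s) * X) ^ 2 + p := by
  have hη : 0 < η := by linarith
  have h1 := log_div_le_one hX h
  have h2 := sq_sub_le_sq_exp_neg_sub hs2 (by linarith : Real.log (X / η) ≤ 2)
  have h3 := exp_neg_log_div hη hX
  have h4 : η - Real.exp (-s) * X = X * (Real.exp (-Real.log (X / η)) - Real.exp (-s)) := by
    rw [h3]; field_simp
  rw [h4]
  have := mul_le_mul_of_nonneg_left h2 (sq_nonneg X)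
  nlinarith

/-- Together with `log_div_le_two_mul` this makes `h = (X - η) / X` and `σ` comparable, so that
weights in `h` can accompany a Gaussian centred at `σ`. -/
theorem div_le_log_div (hη : 0 < η) (hX : 0 < X) : (X - η) / X ≤ Real.log (X / η) := by
  have := one_sub_exp_neg_le (Real.log (X / η))
  rw [exp_neg_log_div hη hX] at this
  have e : (X - η) / X = 1 - η / X := by field_simp
  linarith

theorem log_div_le_two_mul (hX : 0 < X) (h : X / 2 ≤ η) (h2 : η ≤ X) :
    Real.log (X / η) ≤ 2 * ((X - η) / X) := by
  have hη : 0 < η := by linarith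
  have h0 : 0 ≤ Real.log (X / η) := Real.log_nonneg ((one_le_div hη).2 h2)
  have h1 := div_one_add_le_one_sub_exp_neg h0
  rw [exp_neg_log_div hη hX] at h1
  have h3 := log_div_le_one hX h
  have e : (X - η) / X = 1 - η / X := by field_simp
  have h4 : Real.log (X / η) / 2 ≤ Real.log (X / η) / (1 + Real.log (X / η)) :=
    div_le_div_of_nonneg_left h0 (by linarith) (by linarith)
  linarith

/-- When `s` and `σ` are not within a factor `2`, `(s - σ)²` controls both `s²` and `σ²`, and `σ X ≥
X - η`. The resulting constant `81 * 8 = 648` fits under `1000`. -/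
theorem local_of_far (hp : 0 ≤ p) (hX : 0 < X) (h : X / 2 ≤ η) (h2 : η < X) (hs : 0 < s)
    (hs2 : s ≤ 2) (hfar : s < Real.log (X / η) / 2 ∨ 2 * Real.log (X / η) < s) :
    ((X - η) ^ 2 + p) + s ^ 2 * X ^ 2 ≤ 1000 * (((η - Real.exp (-s) * X) ^ 2 + p) + 4 * s) := by
  have hη : 0 < η := by linarith
  have h3 := peak_lower_bound_local (p := p) hX h hs2
  have h4 := div_le_log_div hη hX
  have h0 : 0 < Real.log (X / η) := log_div_pos hη h2
  generalize Real.log (X / η) = σ at *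
  have h5 : X - η ≤ σ * X := (div_le_iff₀ hX).1 h4
  have h6 : (X - η) ^ 2 ≤ (σ * X) ^ 2 := pow_le_pow_left₀ (by linarith) h5 2
  have h7 : σ ^ 2 + s ^ 2 ≤ 8 * (s - σ) ^ 2 := by
    rcases hfar with hf | hf <;> nlinarith
  have h8 := mul_le_mul_of_nonneg_left h7 (sq_nonneg X)
  nlinarith

end Regimes

/-! ### Pointwise domination by the densities. -/

/-- The majorant is dominated pointwise in `s` by the four densities. -/
theorem exists_ouMajorant_le_densities (n : ℕ) {c : ℝ} (hc : 0 < c) :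
    ∃ C : ℝ, 0 < C ∧ ∀ t X η p s : ℝ, 0 < t → 0 ≤ X → 0 ≤ p → 0 < s →
      ouMajorant n (8000 * c) t ((η - Real.exp (-s) * X) ^ 2 + p) s ≤
        C * (ouDensity₁ n c t X η p s + ouDensity₂ n c t X η p s + ouDensity₃ c t η p s +
          ouDensity₄ c t X η p s) := by
  -- The factor `8000` makes both rates come out as `c`: `8000 c * (1/2000) / 4` in the local regime
  -- and `8000 c / 8000` in the global one.
  have ha : 0 < 8000 * c := by positivity
  obtain ⟨C₁, hC₁, H₁⟩ := exists_ouMajorant_le_local n ha (κ := 1 / 2000) (by norm_num)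
    (by norm_num) 2
  obtain ⟨C₃, hC₃, H₃⟩ := exists_ouMajorant_le_global n ha (1 / 8000) 2
  obtain ⟨C₂, hC₂⟩ : ∃ C₂ : ℝ, C₂ = 5 ^ (((n : ℝ) + 3) / 2) := ⟨_, rfl⟩
  obtain ⟨C₄, hC₄⟩ : ∃ C₄ : ℝ, C₄ = 3 ^ ((n : ℝ) / 2) * 2 ^ (3 / 2 : ℝ) := ⟨_, rfl⟩
  have hC₂0 : 0 < C₂ := by rw [hC₂]; positivity
  have hC₄0 : 0 < C₄ := by rw [hC₄]; positivity
  refine ⟨C₁ + C₂ + C₃ + C₄, by positivity, fun t X η p s ht hX hp hs => ?_⟩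
  have n1 := ouDensity₁_nonneg (n := n) (c := c) (X := X) (η := η) ht.le hp hs.le
  have n2 := ouDensity₂_nonneg (n := n) (c := c) (X := X) (η := η) (p := p) (s := s) ht.le
  have n3 := ouDensity₃_nonneg (c := c) (η := η) (p := p) ht.le hs.le
  have n4 := ouDensity₄_nonneg (c := c) (X := X) (η := η) (p := p) (s := s) ht.le
  have hE : 0 ≤ (η - Real.exp (-s) * X) ^ 2 + p := by positivity
  have hD : 0 ≤ (X - η) ^ 2 + p := by positivity
  -- The densities are nonnegative, so for each `s` it is enough that one of them dominates.
  suffices h : ouMajorant n (8000 * c) t ((η - Real.exp (-s) * X) ^ 2 + p) s ≤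
      C₁ * ouDensity₁ n c t X η p s ∨
      ouMajorant n (8000 * c) t ((η - Real.exp (-s) * X) ^ 2 + p) s ≤
      C₂ * ouDensity₂ n c t X η p s ∨
      ouMajorant n (8000 * c) t ((η - Real.exp (-s) * X) ^ 2 + p) s ≤
      C₃ * ouDensity₃ c t η p s ∨
      ouMajorant n (8000 * c) t ((η - Real.exp (-s) * X) ^ 2 + p) s ≤
      C₄ * ouDensity₄ c t X η p s by
    generalize ouDensity₁ n c t X η p s = d1 at *
    generalize ouDensity₂ n c t X η p s = d2 at *
    generalize ouDensity₃ c t η p s = d3 at *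
    generalize ouDensity₄ c t X η p s = d4 at *
    have key : ∀ A d : ℝ, A ≤ C₁ + C₂ + C₃ + C₄ → 0 ≤ d → d ≤ d1 + d2 + d3 + d4 →
        A * d ≤ (C₁ + C₂ + C₃ + C₄) * (d1 + d2 + d3 + d4) := fun A d h1 h2 h3 =>
      mul_le_mul h1 h3 h2 (by positivity)
    rcases h with h | h | h | h <;>
      exact h.trans (key _ _ (by linarith) (by assumption) (by linarith))
  have hlocal (hs2 : s ≤ 2) (h : ((X - η) ^ 2 + p) + s ^ 2 * X ^ 2 ≤
      1000 * (((η - Real.exp (-s) * X) ^ 2 + p) + 4 * s)) :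
      ouMajorant n (8000 * c) t ((η - Real.exp (-s) * X) ^ 2 + p) s ≤
      C₁ * ouDensity₁ n c t X η p s := by
    have := H₁ t _ X _ s ht hD hE hs hs2 (local_condition_of_le hs h)
    rwa [show 8000 * c * (1 / 2000) / 4 = c by ring] at this
  have hglobal (hs4 : 1 / 4 ≤ s)
      (h : 1 / 8000 * (η ^ 2 + p) - 2 ≤ (η - Real.exp (-s) * X) ^ 2 + p) :
      ouMajorant n (8000 * c) t ((η - Real.exp (-s) * X) ^ 2 + p) s ≤
      C₃ * ouDensity₃ c t η p s := by
    have h1 : √(η ^ 2 + p) ^ 2 = η ^ 2 + p := Real.sq_sqrt (by positivity)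
    have := H₃ t (√(η ^ 2 + p)) _ s ht hE hs4 (by rwa [h1])
    rwa [h1, show 8000 * c * (1 / 8000) = c by ring] at this
  rcases le_or_gt X 1 with hX1 | hX1
  · rcases le_total s 2 with hs2 | hs2
    · exact Or.inl (hlocal hs2 (local_of_le_one hX hp hX1 hs hs2))
    · exact Or.inr (Or.inr (Or.inl (hglobal (by linarith) (global_of_le_one hX hp hX1 hs2))))
  have hX0 : 0 < X := by linarith
  rcases le_or_gt X η with h1 | h1
  · rcases le_total s 2 with hs2 | hs2
    · exact Or.inl (hlocal hs2 (local_of_ge hX hp h1 hs hs2))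
    · exact Or.inr (Or.inr (Or.inl (hglobal (by linarith)
        (global_of_half_le hX hp (by linarith) hs2))))
  rcases le_or_gt η 0 with h2 | h2
  · rcases le_total s 2 with hs2 | hs2
    · exact Or.inl (hlocal hs2 (local_of_nonpos hX hp h2 hs hs2))
    · exact Or.inr (Or.inr (Or.inl (hglobal (by linarith) (global_of_nonpos hX hp h2))))
  have hσ : 0 < Real.log (X / η) := log_div_pos h2 h1
  rcases lt_or_ge η (X / 2) with h3 | h3
  · rcases le_total s (1 / 4) with hs4 | hs4
    · exact Or.inl (hlocal (by linarith) (local_of_lt_half hp h2 h3 hs hs4))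
    rcases le_or_gt η 1 with h4 | h4
    · exact Or.inr (Or.inr (Or.inl (hglobal hs4 (global_of_abs_le_one hp h2 h4))))
    rcases le_total (1 / 4) |s - Real.log (X / η)| with h5 | h5
    · exact Or.inr (Or.inr (Or.inl (hglobal hs4 (global_of_far hp h2 hX0 h5))))
    · refine Or.inr (Or.inr (Or.inr ?_))
      -- With `σ ≥ 1/2`, the condition `|s - σ| ≤ 1/4` forces `σ / 2 ≤ s ≤ 2 σ`.
      have hσ2 : 1 / 2 ≤ Real.log (X / η) := by
        have h6 : 2 ≤ X / η := by rw [le_div_iff₀ h2]; linarith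
        have h7 := Real.log_le_log (by norm_num) h6
        linarith [Real.log_two_gt_d9]
      obtain ⟨h8, h9⟩ := abs_le.1 h5
      rw [ouDensity₄, if_pos ⟨h4, h3⟩, hC₄]
      exact ouMajorant_le_peak_global ha (by linarith) ht (by positivity)
        (peak_lower_bound h2 hX0 h5) hs4 hσ (by linarith) (by linarith)
  · rcases le_total 2 s with hs2 | hs2
    · exact Or.inr (Or.inr (Or.inl (hglobal (by linarith) (global_of_half_le hX hp h3 hs2))))
    by_cases hfar : s < Real.log (X / η) / 2 ∨ 2 * Real.log (X / η) < s
    · exact Or.inl (hlocal hs2 (local_of_far hp hX0 h3 h1 hs hs2 hfar))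
    · push Not at hfar
      refine Or.inr (Or.inl ?_)
      -- From `h ≤ σ ≤ 2 h` and `σ / 2 ≤ s ≤ 2 σ` follow `h ≤ 2 s` and `s ≤ 4 h`.
      have h6 := div_le_log_div h2 hX0
      have h7 := log_div_le_two_mul hX0 h3 h1.le
      rw [ouDensity₂, if_pos ⟨hX1, h3, h1⟩, hC₂]
      exact ouMajorant_le_peak_local ha hc (by linarith) ht hp (by positivity)
        (peak_lower_bound_local hX0 h3 hs2) hs hs2 (div_pos (by linarith) hX0)
        (by linarith) (by linarith)

/-! ### Integrals of the densities. -/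

theorem integrableOn_add_rpow_neg {m D : ℝ} (hm : 0 < m) (hD : 0 < D) :
    IntegrableOn (fun s : ℝ => (s + D) ^ (-(m + 1))) (Set.Ioi 0) :=
  integrableOn_add_rpow_Ioi_of_lt (by linarith) (by linarith)

theorem integral_add_rpow_neg {m D : ℝ} (hm : 0 < m) (hD : 0 < D) :
    ∫ s in Set.Ioi (0 : ℝ), (s + D) ^ (-(m + 1)) = D ^ (-m) / m := by
  have h := (measurePreserving_add_right volume D).setIntegral_preimage_emb
    (MeasurableEquiv.addRight D).measurableEmbedding (fun s : ℝ => s ^ (-(m + 1))) (Set.Ioi D)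
  have h2 : (fun s : ℝ => s + D) ⁻¹' Set.Ioi D = Set.Ioi 0 := by ext; simp
  rw [h2] at h
  rw [h, integral_Ioi_rpow_of_lt (by linarith) hD]
  rw [show -(m + 1) + 1 = -m by ring, neg_div_neg_eq]

theorem integrable_gaussian_shift {b : ℝ} (hb : 0 < b) (σ : ℝ) :
    Integrable (fun s : ℝ => Real.exp (-b * (s - σ) ^ 2)) :=
  (integrable_exp_neg_mul_sq hb).comp_sub_right σ

theorem setIntegral_gaussian_shift_le {b : ℝ} (hb : 0 < b) (σ : ℝ) :
    ∫ s in Set.Ioi (0 : ℝ), Real.exp (-b * (s - σ) ^ 2) ≤ √(Real.pi / b) := by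
  rw [← integral_gaussian b, ← integral_sub_right_eq_self (fun s => Real.exp (-b * s ^ 2)) σ]
  exact setIntegral_le_integral (integrable_gaussian_shift hb σ)
    (Filter.Eventually.of_forall fun s => (Real.exp_pos _).le)

/-- Integrating the power lowers the exponent from `(n + 3) / 2` to `(n + 1) / 2` and contributes
the factor `2 / (n + 1) ≤ 2`. -/
theorem integral_ouDensity₁ (n : ℕ) {c t X η p : ℝ} (ht : 0 < t) (hp : 0 ≤ p) :
    IntegrableOn (ouDensity₁ n c t X η p) (Set.Ioi 0) ∧
    ∫ s in Set.Ioi (0 : ℝ), ouDensity₁ n c t X η p s ≤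
      2 * (t / (t ^ 2 + ((X - η) ^ 2 + p)) ^ (((n : ℝ) + 1) / 2) *
        Real.exp (-(c * (t * (1 + X))))) := by
  have hm : 0 < ((n : ℝ) + 1) / 2 := by positivity
  have hD : 0 < t ^ 2 + ((X - η) ^ 2 + p) := by positivity
  have e : ((n : ℝ) + 3) / 2 = ((n : ℝ) + 1) / 2 + 1 := by ring
  unfold ouDensity₁
  rw [e]
  refine ⟨((integrableOn_add_rpow_neg hm hD).const_mul _).mul_const _, ?_⟩
  rw [integral_mul_const, integral_const_mul, integral_add_rpow_neg hm hD, Real.rpow_neg hD.le]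
  have h1 : (((n : ℝ) + 1) / 2)⁻¹ ≤ 2 := by
    rw [inv_div, div_le_iff₀ (by positivity)]
    have : (0 : ℝ) ≤ n := Nat.cast_nonneg n
    linarith
  calc _ = (((n : ℝ) + 1) / 2)⁻¹ * (t / (t ^ 2 + ((X - η) ^ 2 + p)) ^ (((n : ℝ) + 1) / 2) *
        Real.exp (-(c * (t * (1 + X))))) := by simp only [div_eq_mul_inv]; ring
    _ ≤ _ := by gcongr

theorem integral_ouDensity₃ {c t η p : ℝ} (ht : 0 < t) :
    IntegrableOn (ouDensity₃ c t η p) (Set.Ioi 0) ∧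
    ∫ s in Set.Ioi (0 : ℝ), ouDensity₃ c t η p s ≤
      2 * (min 1 t * Real.exp (-(c * (η ^ 2 + p)))) := by
  have hm : (0 : ℝ) < 1 / 2 := by norm_num
  have hD : 0 < t ^ 2 + 1 := by positivity
  have e : (3 / 2 : ℝ) = 1 / 2 + 1 := by norm_num
  unfold ouDensity₃
  rw [e]
  refine ⟨((integrableOn_add_rpow_neg hm hD).const_mul _).mul_const _, ?_⟩
  rw [integral_mul_const, integral_const_mul, integral_add_rpow_neg hm hD, Real.rpow_neg hD.le,
    ← Real.sqrt_eq_rpow]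
  -- This is the source of `min 1 t` in `K₃`.
  have h1 : t / √(t ^ 2 + 1) ≤ min 1 t := by
    refine le_min ?_ (div_le_self ht.le (by rw [Real.one_le_sqrt]; nlinarith))
    rw [div_le_one (by positivity)]
    exact Real.le_sqrt_of_sq_le (by linarith)
  calc _ = 2 * (t / √(t ^ 2 + 1) * Real.exp (-(c * (η ^ 2 + p)))) := by
        simp only [div_eq_mul_inv]; ring
    _ ≤ _ := by gcongr

/-- A Gaussian of width of order `1 / η` supplies the factor `1 / η`. -/
theorem integral_ouDensity₄ {c t X η p : ℝ} (hc : 0 < c) (ht : 0 < t) :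
    IntegrableOn (ouDensity₄ c t X η p) (Set.Ioi 0) ∧
    ∫ s in Set.Ioi (0 : ℝ), ouDensity₄ c t X η p s ≤
      √(4 * Real.pi / c) * (if 1 < η ∧ η < X / 2 then
        t / η * Real.log (X / η) ^ (-(3 / 2) : ℝ) *
          Real.exp (-(c * (t ^ 2 / Real.log (X / η)))) * Real.exp (-(c * p)) else 0) := by
  unfold ouDensity₄
  split_ifs with h
  · have hη : 0 < η := by linarith
    have hσ : 0 < Real.log (X / η) := log_div_pos hη (by linarith)
    generalize Real.log (X / η) = σ at *
    have hb : 0 < c * η ^ 2 / 4 := by positivity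
    have e : (fun s : ℝ => t * σ ^ (-(3 / 2) : ℝ) * Real.exp (-(c * (t ^ 2 / σ))) *
        Real.exp (-(c * (η ^ 2 * (s - σ) ^ 2 / 4 + p)))) = fun s =>
        t * σ ^ (-(3 / 2) : ℝ) * Real.exp (-(c * (t ^ 2 / σ))) * Real.exp (-(c * p)) *
        Real.exp (-(c * η ^ 2 / 4) * (s - σ) ^ 2) := by
      funext s
      rw [mul_assoc _ (Real.exp (-(c * p))), ← Real.exp_add]
      congr 2; ring
    rw [e]
    refine ⟨(integrable_gaussian_shift hb σ).integrableOn.const_mul _, ?_⟩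
    rw [integral_const_mul]
    have h1 := setIntegral_gaussian_shift_le hb σ
    have h2 : √(Real.pi / (c * η ^ 2 / 4)) = √(4 * Real.pi / c) / η := by
      rw [show Real.pi / (c * η ^ 2 / 4) = 4 * Real.pi / c / η ^ 2 by field_simp,
        Real.sqrt_div (by positivity), Real.sqrt_sq hη.le]
    rw [h2] at h1
    refine (mul_le_mul_of_nonneg_left h1 (by positivity)).trans (le_of_eq ?_)
    ring
  · simp

/-- The Gaussian has width of order `√h / X`, which turns `h^{-(n+3)/2}` into `h^{-(n+2)/2} / X`.
Half of the exponential in `(t² + p) / h` then replaces `h` by `t² + h + p`; the other half remains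
in `K₂`. -/
theorem integral_ouDensity₂ (n : ℕ) {c : ℝ} (hc : 0 < c) :
    ∃ C : ℝ, 0 < C ∧ ∀ t X η p : ℝ, 0 < t → 0 ≤ p →
    IntegrableOn (ouDensity₂ n c t X η p) (Set.Ioi 0) ∧
    ∫ s in Set.Ioi (0 : ℝ), ouDensity₂ n c t X η p s ≤
      C * (if 1 < X ∧ X / 2 ≤ η ∧ η < X then
        t / X * (t ^ 2 + (X - η) / X + p) ^ (-(((n : ℝ) + 2) / 2)) *
          Real.exp (-(c * ((t ^ 2 + p) / ((X - η) / X)))) else 0) := by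
  obtain ⟨C, hC, hCb⟩ := exists_rpow_neg_mul_exp_le (k := ((n : ℝ) + 2) / 2) (β := c)
    (by positivity) hc
  refine ⟨√(81 * Real.pi / (2 * c)) * C, by positivity, fun t X η p ht hp => ?_⟩
  unfold ouDensity₂
  split_ifs with h
  · have hX : 0 < X := by linarith
    have hh : 0 < (X - η) / X := div_pos (by linarith) hX
    generalize Real.log (X / η) = σ
    generalize (X - η) / X = h at *
    have hb : 0 < 2 * c * X ^ 2 / 81 / h := by positivity
    have e : ∀ s : ℝ, -(2 * c * (X ^ 2 * (s - σ) ^ 2 / 81 / h)) =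
        -(2 * c * X ^ 2 / 81 / h) * (s - σ) ^ 2 := fun s => by ring
    simp only [e]
    refine ⟨(integrable_gaussian_shift hb σ).integrableOn.const_mul _, ?_⟩
    rw [integral_const_mul]
    have h1 := setIntegral_gaussian_shift_le hb σ
    have h2 : √(Real.pi / (2 * c * X ^ 2 / 81 / h)) = √(81 * Real.pi / (2 * c)) * √h / X := by
      rw [show Real.pi / (2 * c * X ^ 2 / 81 / h) = 81 * Real.pi / (2 * c) * h / X ^ 2 by
        field_simp, Real.sqrt_div (by positivity), Real.sqrt_sq hX.le,
        Real.sqrt_mul (by positivity)]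
    have h3 : h ^ (-(((n : ℝ) + 3) / 2)) * √h = h ^ (-(((n : ℝ) + 2) / 2)) := by
      rw [Real.sqrt_eq_rpow, ← Real.rpow_add hh]; congr 1; ring
    have h4 : Real.exp (-(2 * c * ((t ^ 2 + p) / h))) =
        Real.exp (-(c * ((t ^ 2 + p) / h))) * Real.exp (-(c * ((t ^ 2 + p) / h))) := by
      rw [← Real.exp_add]; congr 1; ring
    have h5 := hCb h (t ^ 2 + p) hh (by positivity)
    rw [show h + (t ^ 2 + p) = t ^ 2 + h + p by ring] at h5
    rw [h2] at h1
    refine (mul_le_mul_of_nonneg_left h1 (by positivity)).trans ?_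
    calc _ = √(81 * Real.pi / (2 * c)) * (t / X) * Real.exp (-(c * ((t ^ 2 + p) / h))) *
          (h ^ (-(((n : ℝ) + 2) / 2)) * Real.exp (-(c * ((t ^ 2 + p) / h)))) := by
          rw [← h3, h4]; ring
      _ ≤ √(81 * Real.pi / (2 * c)) * (t / X) * Real.exp (-(c * ((t ^ 2 + p) / h))) *
          (C * (t ^ 2 + h + p) ^ (-(((n : ℝ) + 2) / 2))) := by gcongr
      _ = _ := by ring
  · simp

theorem measurable_ouMajorant (n : ℕ) (a t X η p : ℝ) :
    Measurable fun s : ℝ => ouMajorant n a t ((η - Real.exp (-s) * X) ^ 2 + p) s := by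
  unfold ouMajorant
  fun_prop

/-- The integral of the majorant, in terms of the scalars `X = ‖x‖`, `η = ± ‖y_x‖` and
`p = ‖y_x'‖²`. -/
theorem exists_integral_ouMajorant_le (n : ℕ) {c : ℝ} (hc : 0 < c) :
    ∃ C : ℝ, 0 < C ∧ ∀ t X η p : ℝ, 0 < t → 0 ≤ X → 0 ≤ p →
      IntegrableOn (fun s => ouMajorant n (8000 * c) t ((η - Real.exp (-s) * X) ^ 2 + p) s)
        (Set.Ioi 0) ∧
      ∫ s in Set.Ioi (0 : ℝ), ouMajorant n (8000 * c) t ((η - Real.exp (-s) * X) ^ 2 + p) s ≤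
        C * (t / (t ^ 2 + ((X - η) ^ 2 + p)) ^ (((n : ℝ) + 1) / 2) *
            Real.exp (-(c * (t * (1 + X)))) +
          (if 1 < X ∧ X / 2 ≤ η ∧ η < X then
            t / X * (t ^ 2 + (X - η) / X + p) ^ (-(((n : ℝ) + 2) / 2)) *
            Real.exp (-(c * ((t ^ 2 + p) / ((X - η) / X)))) else 0) +
          min 1 t * Real.exp (-(c * (η ^ 2 + p))) +
          (if 1 < η ∧ η < X / 2 then
            t / η * Real.log (X / η) ^ (-(3 / 2) : ℝ) *
            Real.exp (-(c * (t ^ 2 / Real.log (X / η)))) * Real.exp (-(c * p)) else 0)) := by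
  obtain ⟨C, hC, H⟩ := exists_ouMajorant_le_densities n hc
  obtain ⟨C₂, hC₂, H₂⟩ := integral_ouDensity₂ n hc
  obtain ⟨C₄, hC₄⟩ : ∃ C₄ : ℝ, C₄ = √(4 * Real.pi / c) := ⟨_, rfl⟩
  have hC₄0 : 0 ≤ C₄ := by rw [hC₄]; positivity
  refine ⟨C * (2 + C₂ + C₄), by positivity, fun t X η p ht hX hp => ?_⟩
  obtain ⟨i1, b1⟩ := integral_ouDensity₁ n (c := c) (X := X) (η := η) ht hp
  obtain ⟨i2, b2⟩ := H₂ t X η p ht hp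
  obtain ⟨i3, b3⟩ := integral_ouDensity₃ (c := c) (η := η) (p := p) ht
  obtain ⟨i4, b4⟩ := integral_ouDensity₄ (X := X) (η := η) (p := p) hc ht
  rw [← hC₄] at b4
  have hint : IntegrableOn (fun s => C * (ouDensity₁ n c t X η p s + ouDensity₂ n c t X η p s +
      ouDensity₃ c t η p s + ouDensity₄ c t X η p s)) (Set.Ioi 0) :=
    (((i1.add i2).add i3).add i4).const_mul C
  have hle : ∀ s ∈ Set.Ioi (0 : ℝ),
      ouMajorant n (8000 * c) t ((η - Real.exp (-s) * X) ^ 2 + p) s ≤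
      C * (ouDensity₁ n c t X η p s + ouDensity₂ n c t X η p s +
      ouDensity₃ c t η p s + ouDensity₄ c t X η p s) :=
    fun s hs => H t X η p s ht hX hp hs
  have hmaj : IntegrableOn
      (fun s => ouMajorant n (8000 * c) t ((η - Real.exp (-s) * X) ^ 2 + p) s) (Set.Ioi 0) := by
    refine Integrable.mono' hint (measurable_ouMajorant n _ t X η p).aestronglyMeasurable ?_
    filter_upwards [ae_restrict_mem measurableSet_Ioi] with s hs
    rw [Real.norm_of_nonneg (ouMajorant_nonneg ht.le hs)]
    exact hle s hs
  refine ⟨hmaj, (setIntegral_mono_on hmaj hint measurableSet_Ioi hle).trans ?_⟩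
  have e : ∫ s in Set.Ioi (0 : ℝ), C * (ouDensity₁ n c t X η p s + ouDensity₂ n c t X η p s +
      ouDensity₃ c t η p s + ouDensity₄ c t X η p s) =
      C * ((∫ s in Set.Ioi (0 : ℝ), ouDensity₁ n c t X η p s) +
        (∫ s in Set.Ioi (0 : ℝ), ouDensity₂ n c t X η p s) +
        (∫ s in Set.Ioi (0 : ℝ), ouDensity₃ c t η p s) +
        ∫ s in Set.Ioi (0 : ℝ), ouDensity₄ c t X η p s) := by
    rw [integral_const_mul]
    congr 1
    have j2 := integral_add (i1.add i2) i3
    have j3 := integral_add ((i1.add i2).add i3) i4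
    simp only [Pi.add_apply] at j2 j3
    rw [j3, j2, integral_add i1 i2]
  rw [e, mul_assoc]
  refine mul_le_mul_of_nonneg_left ?_ hC.le
  have k1 : 0 ≤ t / (t ^ 2 + ((X - η) ^ 2 + p)) ^ (((n : ℝ) + 1) / 2) *
      Real.exp (-(c * (t * (1 + X)))) := by positivity
  have k2 : 0 ≤ (if 1 < X ∧ X / 2 ≤ η ∧ η < X then
      t / X * (t ^ 2 + (X - η) / X + p) ^ (-(((n : ℝ) + 2) / 2)) *
      Real.exp (-(c * ((t ^ 2 + p) / ((X - η) / X)))) else 0) := by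
    split_ifs with h
    · have : 0 ≤ X - η := by linarith
      positivity
    · exact le_rfl
  have k3 : 0 ≤ min 1 t * Real.exp (-(c * (η ^ 2 + p))) := by positivity
  have k4 : 0 ≤ (if 1 < η ∧ η < X / 2 then
      t / η * Real.log (X / η) ^ (-(3 / 2) : ℝ) *
      Real.exp (-(c * (t ^ 2 / Real.log (X / η)))) * Real.exp (-(c * p)) else 0) := by
    split_ifs with h
    · have : 0 < Real.log (X / η) := log_div_pos (by linarith) (by linarith)
      have : 0 < η := by linarith
      positivity
    · exact le_rfl
  refine (add_le_add (add_le_add (add_le_add b1 b2) b3) b4).trans ?_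
  generalize t / (t ^ 2 + ((X - η) ^ 2 + p)) ^ (((n : ℝ) + 1) / 2) *
      Real.exp (-(c * (t * (1 + X)))) = z1 at *
  generalize (if 1 < X ∧ X / 2 ≤ η ∧ η < X then
      t / X * (t ^ 2 + (X - η) / X + p) ^ (-(((n : ℝ) + 2) / 2)) *
      Real.exp (-(c * ((t ^ 2 + p) / ((X - η) / X)))) else 0) = z2 at *
  generalize min 1 t * Real.exp (-(c * (η ^ 2 + p))) = z3 at *
  generalize (if 1 < η ∧ η < X / 2 then
      t / η * Real.log (X / η) ^ (-(3 / 2) : ℝ) *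
      Real.exp (-(c * (t ^ 2 / Real.log (X / η)))) * Real.exp (-(c * p)) else 0) = z4 at *
  have : (2 + C₂ + C₄) * (z1 + z2 + z3 + z4) - (2 * z1 + C₂ * z2 + 2 * z3 + C₄ * z4) =
      (C₂ + C₄) * z1 + (2 + C₄) * z2 + (C₂ + C₄) * z3 + (2 + C₂) * z4 := by ring
  have : 0 ≤ (C₂ + C₄) * z1 + (2 + C₄) * z2 + (C₂ + C₄) * z3 + (2 + C₂) * z4 := by positivity
  linarith

/-! ### Back from scalars to vectors. -/

section Geometry

variable {n : ℕ} {x y : EuclideanSpace ℝ (Fin n)}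

/-- Pythagoras: the signed length of `y_x` is `⟨x, y⟩ / ‖x‖`. -/
theorem norm_sub_smul_sq (hx : x ≠ 0) (r : ℝ) :
    ‖y - r • x‖ ^ 2 = (inner ℝ x y / ‖x‖ - r * ‖x‖) ^ 2 + ‖perpPart x y‖ ^ 2 := by
  have hx' : ‖x‖ ≠ 0 := norm_ne_zero_iff.2 hx
  have h1 : ∀ a : ℝ, ‖y - a • x‖ ^ 2 = ‖y‖ ^ 2 - 2 * (a * inner ℝ x y) + a ^ 2 * ‖x‖ ^ 2 := by
    intro a
    rw [norm_sub_sq_real, inner_smul_right, real_inner_comm, norm_smul, mul_pow,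
      Real.norm_eq_abs, sq_abs]
  rw [perpPart, parPart, if_neg hx, h1, h1]
  field_simp
  ring

theorem norm_parPart (hx : x ≠ 0) (h : 0 ≤ inner ℝ x y) :
    ‖parPart x y‖ = inner ℝ x y / ‖x‖ := by
  have hx' : ‖x‖ ≠ 0 := norm_ne_zero_iff.2 hx
  rw [parPart, if_neg hx, norm_smul, Real.norm_of_nonneg (by positivity)]
  field_simp

theorem norm_sub_parPart (hx : x ≠ 0) (h : inner ℝ x y / ‖x‖ ≤ ‖x‖) :
    ‖x - parPart x y‖ = ‖x‖ - inner ℝ x y / ‖x‖ := by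
  have hx' : 0 < ‖x‖ := norm_pos_iff.2 hx
  have h1 : x - parPart x y = (1 - inner ℝ x y / ‖x‖ ^ 2) • x := by
    rw [parPart, if_neg hx, sub_smul, one_smul]
  have h2 : 0 ≤ 1 - inner ℝ x y / ‖x‖ ^ 2 := by
    rw [sub_nonneg, div_le_one (by positivity)]
    rw [div_le_iff₀ hx'] at h
    linarith
  rw [h1, norm_smul, Real.norm_of_nonneg h2]
  field_simp

end Geometry

theorem ouK2_nonneg {n : ℕ} {c t : ℝ} (ht : 0 ≤ t) (x y : EuclideanSpace ℝ (Fin n)) :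
    0 ≤ ouK2 c t x y := by
  unfold ouK2; split_ifs
  · positivity
  · exact le_rfl

theorem ouK4_nonneg {n : ℕ} {c t : ℝ} (ht : 0 ≤ t) (x y : EuclideanSpace ℝ (Fin n)) :
    0 ≤ ouK4 c t x y := by
  unfold ouK4; split_ifs with h
  · have : 0 < Real.log (‖x‖ / ‖parPart x y‖) :=
      log_div_pos (by linarith) (by linarith [norm_nonneg x])
    positivity
  · exact le_rfl

/-- The integral of the majorant is controlled by the four kernels. -/
theorem exists_integral_ouMajorant_le_kernels (n : ℕ) {c : ℝ} (hc : 0 < c) :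
    ∃ C : ℝ, 0 < C ∧ ∀ t : ℝ, 0 < t → ∀ x y : EuclideanSpace ℝ (Fin n),
      IntegrableOn (fun s => ouMajorant n (8000 * c) t (‖y - Real.exp (-s) • x‖ ^ 2) s)
        (Set.Ioi 0) ∧
      ∫ s in Set.Ioi (0 : ℝ), ouMajorant n (8000 * c) t (‖y - Real.exp (-s) • x‖ ^ 2) s ≤
        C * (ouK1 c t x y + ouK2 c t x y + ouK3 c t x y + ouK4 c t x y) := by
  obtain ⟨C, hC, H⟩ := exists_integral_ouMajorant_le n hc
  refine ⟨C, hC, fun t ht x y => ?_⟩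
  by_cases hx : x = 0
  -- At `x = 0` the convention `y_x = y`, `y_x' = 0` corresponds to `X = 0`, `η = ‖y‖`, `p = 0`; the
  -- `K₂` and `K₄` terms vanish.
  · obtain ⟨h1, h2⟩ := H t 0 ‖y‖ 0 ht le_rfl le_rfl
    subst hx
    simp only [mul_zero, sub_zero, add_zero, smul_zero, zero_sub, neg_sq] at h1 h2 ⊢
    refine ⟨h1, h2.trans (mul_le_mul_of_nonneg_left ?_ hC.le)⟩
    have e2 : ¬(1 < (0 : ℝ) ∧ (0 : ℝ) / 2 ≤ ‖y‖ ∧ ‖y‖ < 0) := by rintro ⟨h, -⟩; linarith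
    have e4 : ¬(1 < ‖y‖ ∧ ‖y‖ < 0 / 2) := by rintro ⟨h, h'⟩; linarith
    rw [if_neg e2, if_neg e4, ouK1, ouK3]
    have := ouK2_nonneg (c := c) ht.le 0 y
    have := ouK4_nonneg (c := c) ht.le 0 y
    simp only [zero_sub, norm_neg, norm_zero, add_zero]
    linarith
  · have hE : ∀ r : ℝ, ‖y - r • x‖ ^ 2 =
        (inner ℝ x y / ‖x‖ - r * ‖x‖) ^ 2 + ‖perpPart x y‖ ^ 2 := norm_sub_smul_sq hx
    have hX : 0 < ‖x‖ := norm_pos_iff.2 hx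
    obtain ⟨h1, h2⟩ := H t ‖x‖ (inner ℝ x y / ‖x‖) (‖perpPart x y‖ ^ 2) ht hX.le (by positivity)
    simp only [hE]
    refine ⟨h1, h2.trans (mul_le_mul_of_nonneg_left ?_ hC.le)⟩
    refine add_le_add (add_le_add (add_le_add (le_of_eq ?_) ?_) (le_of_eq ?_)) ?_
    -- The identity at `r = 1` gives `‖x - y‖²` for `K₁`; below, `r = 0` gives `‖y‖²` for `K₃`.
    · have := hE 1
      rw [one_smul, one_mul, norm_sub_rev] at this
      rw [ouK1, this]
      congr 4; ring
    · split_ifs with h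
      · have hη : 0 < inner ℝ x y / ‖x‖ := by linarith
        have hin : 0 < inner ℝ x y := by
          have := mul_pos hη hX
          rwa [div_mul_cancel₀ _ hX.ne'] at this
        have e1 := norm_parPart hx hin.le
        have e2 := norm_sub_parPart hx h.2.2.le
        rw [ouK2, e1, e2, if_pos ⟨h.1, hin, h.2⟩, div_div_eq_mul_div]
      · exact ouK2_nonneg ht.le x y
    · have := hE 0
      rw [zero_smul, sub_zero, zero_mul, sub_zero] at this
      rw [ouK3, this]
    · split_ifs with h
      · have hη : 0 < inner ℝ x y / ‖x‖ := by linarith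
        have hin : 0 < inner ℝ x y := by
          have := mul_pos hη hX
          rwa [div_mul_cancel₀ _ hX.ne'] at this
        have e1 := norm_parPart hx hin.le
        rw [ouK4, e1, if_pos ⟨hin, h⟩]
      · exact ouK4_nonneg ht.le x y

/-! ### The subordinated integrand and its derivatives. -/

/-- The integrand of the Ornstein-Uhlenbeck Poisson kernel in the variable `s = t² / (4u)`. -/
noncomputable def ouSubordinated {n : ℕ} (t : ℝ) (x y : EuclideanSpace ℝ (Fin n)) (s : ℝ) : ℝ :=
  t / s ^ (3 / 2 : ℝ) * Real.exp (-(t ^ 2 / (4 * s))) *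
    (Real.exp (-(‖y - Real.exp (-s) • x‖ ^ 2 / (1 - Real.exp (-(2 * s))))) /
      (1 - Real.exp (-(2 * s))) ^ ((n : ℝ) / 2))

/-- The derivative of `ouSubordinated` in `t`. -/
noncomputable def ouSubordinatedDerivTime {n : ℕ} (t : ℝ) (x y : EuclideanSpace ℝ (Fin n))
    (s : ℝ) : ℝ :=
  (1 - t ^ 2 / (2 * s)) / s ^ (3 / 2 : ℝ) * Real.exp (-(t ^ 2 / (4 * s))) *
    (Real.exp (-(‖y - Real.exp (-s) • x‖ ^ 2 / (1 - Real.exp (-(2 * s))))) /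
      (1 - Real.exp (-(2 * s))) ^ ((n : ℝ) / 2))

/-- The derivative of `ouSubordinated` in `x`, in the direction `v`. -/
noncomputable def ouSubordinatedDerivSpace {n : ℕ} (t : ℝ) (x y v : EuclideanSpace ℝ (Fin n))
    (s : ℝ) : ℝ :=
  ouSubordinated t x y s *
    (2 * Real.exp (-s) * inner ℝ (y - Real.exp (-s) • x) v / (1 - Real.exp (-(2 * s))))

section

variable {n : ℕ} {x y v : EuclideanSpace ℝ (Fin n)} {t s : ℝ}

theorem hasDerivAt_ouSubordinated_time (x y : EuclideanSpace ℝ (Fin n)) (t : ℝ) (hs : 0 < s) :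
    HasDerivAt (fun τ => ouSubordinated τ x y s) (ouSubordinatedDerivTime t x y s) t := by
  have h1 : HasDerivAt (fun τ : ℝ => τ / s ^ (3 / 2 : ℝ)) (1 / s ^ (3 / 2 : ℝ)) t :=
    (hasDerivAt_id t).div_const _
  have h2 : HasDerivAt (fun τ : ℝ => -(τ ^ 2 / (4 * s))) (-((2 : ℕ) * t ^ (2 - 1) / (4 * s))) t :=
    ((hasDerivAt_pow 2 t).div_const _).neg
  refine ((h1.mul h2.exp).mul_const (Real.exp (-(‖y - Real.exp (-s) • x‖ ^ 2 /
    (1 - Real.exp (-(2 * s))))) / (1 - Real.exp (-(2 * s))) ^ ((n : ℝ) / 2))).congr_deriv ?_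
  unfold ouSubordinatedDerivTime
  have := Real.rpow_pos_of_pos hs (3 / 2)
  congr 1
  norm_num
  field_simp
  ring

theorem hasDerivAt_ouSubordinated_line (t s h : ℝ) (x y v : EuclideanSpace ℝ (Fin n)) :
    HasDerivAt (fun h : ℝ => ouSubordinated t (x + h • v) y s)
      (ouSubordinatedDerivSpace t (x + h • v) y v s) h := by
  have h1 : HasDerivAt (fun h : ℝ => y - Real.exp (-s) • (x + h • v))
      (-(Real.exp (-s) • v)) h := by
    have := ((((hasDerivAt_id h).smul_const v).const_add x).const_smul (Real.exp (-s))).const_sub y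
    simpa using this
  have h2 := h1.norm_sq
  have h3 := (((h2.div_const (1 - Real.exp (-(2 * s)))).neg.exp.div_const
    ((1 - Real.exp (-(2 * s))) ^ ((n : ℝ) / 2))).const_mul
    (t / s ^ (3 / 2 : ℝ) * Real.exp (-(t ^ 2 / (4 * s)))))
  refine h3.congr_deriv ?_
  unfold ouSubordinatedDerivSpace ouSubordinated
  rw [inner_neg_right, inner_smul_right]
  simp only [Pi.neg_apply]
  ring

theorem ouSubordinated_nonneg (ht : 0 ≤ t) (hs : 0 < s) : 0 ≤ ouSubordinated t x y s := by
  have := one_sub_exp_neg_two_mul_pos hs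
  unfold ouSubordinated
  positivity

theorem ouSubordinated_le (ht : 0 ≤ t) (hs : 0 < s) :
    ouSubordinated t x y s ≤ ouMajorant n (1 / 8) t (‖y - Real.exp (-s) • x‖ ^ 2) s := by
  have h0 := one_sub_exp_neg_two_mul_pos hs
  unfold ouSubordinated ouMajorant
  have h1 : 1 / 8 * (t ^ 2 / s) ≤ t ^ 2 / (4 * s) := by
    rw [← sub_nonneg, show t ^ 2 / (4 * s) - 1 / 8 * (t ^ 2 / s) = 1 / 8 * (t ^ 2 / s) by
      field_simp; ring]
    positivity
  have h2 : 1 / 8 * (‖y - Real.exp (-s) • x‖ ^ 2 / (1 - Real.exp (-(2 * s)))) ≤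
      ‖y - Real.exp (-s) • x‖ ^ 2 / (1 - Real.exp (-(2 * s))) :=
    mul_le_of_le_one_left (by positivity) (by norm_num)
  gcongr

/-- Half of the exponent `t² / (4 s)` absorbs the factor `1 - t² / (2 s)`, leaving the rate `1/8`.
-/
theorem abs_ouSubordinatedDerivTime_le (ht : 0 < t) (hs : 0 < s) :
    t * |ouSubordinatedDerivTime t x y s| ≤
      4 * ouMajorant n (1 / 8) t (‖y - Real.exp (-s) • x‖ ^ 2) s := by
  have h0 := one_sub_exp_neg_two_mul_pos hs
  have h2 : 1 / 8 * (‖y - Real.exp (-s) • x‖ ^ 2 / (1 - Real.exp (-(2 * s)))) ≤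
      ‖y - Real.exp (-s) • x‖ ^ 2 / (1 - Real.exp (-(2 * s))) :=
    mul_le_of_le_one_left (by positivity) (by norm_num)
  have h3 : |1 - t ^ 2 / (2 * s)| * Real.exp (-(t ^ 2 / (4 * s))) ≤
      4 * Real.exp (-(1 / 8 * (t ^ 2 / s))) := by
    have e1 : |1 - t ^ 2 / (2 * s)| ≤ 1 + 4 * (1 / 8 * (t ^ 2 / s)) := by
      have e : t ^ 2 / (2 * s) = 4 * (1 / 8 * (t ^ 2 / s)) := by field_simp; ring
      have : 0 ≤ 1 / 8 * (t ^ 2 / s) := by positivity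
      rw [e, abs_le]; constructor <;> linarith
    have e2 : 1 + 4 * (1 / 8 * (t ^ 2 / s)) ≤ 4 * Real.exp (1 / 8 * (t ^ 2 / s)) := by
      linarith [Real.add_one_le_exp (1 / 8 * (t ^ 2 / s))]
    have e3 : Real.exp (1 / 8 * (t ^ 2 / s)) * Real.exp (-(t ^ 2 / (4 * s))) =
        Real.exp (-(1 / 8 * (t ^ 2 / s))) := by
      rw [← Real.exp_add]; congr 1; field_simp; ring
    calc _ ≤ 4 * Real.exp (1 / 8 * (t ^ 2 / s)) * Real.exp (-(t ^ 2 / (4 * s))) := by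
          gcongr; exact e1.trans e2
      _ = _ := by rw [mul_assoc, e3]
  calc t * |ouSubordinatedDerivTime t x y s| = t * (s ^ (3 / 2 : ℝ))⁻¹ *
        (|1 - t ^ 2 / (2 * s)| * Real.exp (-(t ^ 2 / (4 * s)))) *
        (Real.exp (-(‖y - Real.exp (-s) • x‖ ^ 2 / (1 - Real.exp (-(2 * s))))) *
          ((1 - Real.exp (-(2 * s))) ^ ((n : ℝ) / 2))⁻¹) := by
        unfold ouSubordinatedDerivTime
        rw [abs_mul, abs_mul, abs_div, abs_div, Real.abs_exp, Real.abs_exp,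
          abs_of_pos (Real.rpow_pos_of_pos hs _), abs_of_pos (Real.rpow_pos_of_pos h0 _)]
        ring
    _ ≤ t * (s ^ (3 / 2 : ℝ))⁻¹ * (4 * Real.exp (-(1 / 8 * (t ^ 2 / s)))) *
        (Real.exp (-(1 / 8 * (‖y - Real.exp (-s) • x‖ ^ 2 / (1 - Real.exp (-(2 * s)))))) *
          ((1 - Real.exp (-(2 * s))) ^ ((n : ℝ) / 2))⁻¹) := by gcongr
    _ = _ := by unfold ouMajorant; ring

/-- With `z = t / √s` and `w = |y - e^{-s} x| / √(1 - e^{-2s})`, the extra factor is at most `2 z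
w`, because `e^{-s} / √(1 - e^{-2s}) ≤ 1 / √s`. The factors `z` and `w` are then absorbed by
`e^{-z²/4}` and `e^{-w²}`. -/
theorem abs_ouSubordinatedDerivSpace_le (ht : 0 < t) (hs : 0 < s) (hv : ‖v‖ ≤ 1) :
    t * |ouSubordinatedDerivSpace t x y v s| ≤
      4 * ouMajorant n (1 / 8) t (‖y - Real.exp (-s) • x‖ ^ 2) s := by
  have h0 := one_sub_exp_neg_two_mul_pos hs
  obtain ⟨w, hw⟩ : ∃ w, w = ‖y - Real.exp (-s) • x‖ / √(1 - Real.exp (-(2 * s))) := ⟨_, rfl⟩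
  obtain ⟨z, hz⟩ : ∃ z, z = t / √s := ⟨_, rfl⟩
  have hw0 : 0 ≤ w := by rw [hw]; positivity
  have hz0 : 0 ≤ z := by rw [hz]; positivity
  have hw2 : w ^ 2 = ‖y - Real.exp (-s) • x‖ ^ 2 / (1 - Real.exp (-(2 * s))) := by
    rw [hw, div_pow, Real.sq_sqrt h0.le]
  have hz2 : z ^ 2 = t ^ 2 / s := by rw [hz, div_pow, Real.sq_sqrt hs.le]
  have hz4 : t ^ 2 / (4 * s) = z ^ 2 / 4 := by rw [hz2]; field_simp
  have h1 : Real.exp (-s) / √(1 - Real.exp (-(2 * s))) ≤ 1 / √s := by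
    rw [div_le_div_iff₀ (Real.sqrt_pos.2 h0) (Real.sqrt_pos.2 hs), one_mul]
    refine Real.le_sqrt_of_sq_le ?_
    rw [mul_pow, Real.sq_sqrt hs.le]
    have e1 : Real.exp (-s) ^ 2 = Real.exp (-(2 * s)) := by
      rw [← Real.exp_nat_mul]; congr 1; push_cast; ring
    have e2 : Real.exp (-(2 * s)) * Real.exp (2 * s) = 1 := by
      rw [← Real.exp_add]; simp
    -- The bound `s e^{-2s} ≤ 1 - e^{-2s}` follows from `e^{2s} ≥ 1 + 2 s`.
    have e3 := mul_le_mul_of_nonneg_left (Real.add_one_le_exp (2 * s))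
      (Real.exp_pos (-(2 * s))).le
    rw [e1]
    nlinarith [Real.exp_pos (-(2 * s))]
  have h2 : t * |2 * Real.exp (-s) * inner ℝ (y - Real.exp (-s) • x) v /
      (1 - Real.exp (-(2 * s)))| ≤ 2 * z * w := by
    rw [abs_div, abs_of_pos h0, abs_mul, abs_of_pos (by positivity : 0 < 2 * Real.exp (-s))]
    have e1 : |inner ℝ (y - Real.exp (-s) • x) v| ≤ ‖y - Real.exp (-s) • x‖ :=
      (abs_real_inner_le_norm _ _).trans (mul_le_of_le_one_right (norm_nonneg _) hv)
    have e2 : 1 - Real.exp (-(2 * s)) =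
        √(1 - Real.exp (-(2 * s))) * √(1 - Real.exp (-(2 * s))) := (Real.mul_self_sqrt h0.le).symm
    calc _ ≤ t * (2 * Real.exp (-s) * ‖y - Real.exp (-s) • x‖ / (1 - Real.exp (-(2 * s)))) := by
          gcongr
      _ = 2 * t * (Real.exp (-s) / √(1 - Real.exp (-(2 * s)))) * w := by
          rw [hw]; nth_rewrite 1 [e2]; field_simp
      _ ≤ 2 * t * (1 / √s) * w := by gcongr
      _ = _ := by rw [hz]; ring
  have h3 : z * Real.exp (-(z ^ 2 / 4)) ≤ 2 * Real.exp (-(1 / 8 * z ^ 2)) := by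
    have e1 : z ≤ 2 * Real.exp (z ^ 2 / 8) := by
      nlinarith [Real.add_one_le_exp (z ^ 2 / 8), sq_nonneg (z - 2)]
    have e2 : Real.exp (z ^ 2 / 8) * Real.exp (-(z ^ 2 / 4)) = Real.exp (-(1 / 8 * z ^ 2)) := by
      rw [← Real.exp_add]; congr 1; ring
    calc _ ≤ 2 * Real.exp (z ^ 2 / 8) * Real.exp (-(z ^ 2 / 4)) := by gcongr
      _ = _ := by rw [mul_assoc, e2]
  have h4 : w * Real.exp (-w ^ 2) ≤ Real.exp (-(1 / 8 * w ^ 2)) := by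
    have e1 : w ≤ Real.exp (7 / 8 * w ^ 2) := by
      nlinarith [Real.add_one_le_exp (7 / 8 * w ^ 2), sq_nonneg (w - 1)]
    have e2 : Real.exp (7 / 8 * w ^ 2) * Real.exp (-w ^ 2) = Real.exp (-(1 / 8 * w ^ 2)) := by
      rw [← Real.exp_add]; congr 1; ring
    calc _ ≤ Real.exp (7 / 8 * w ^ 2) * Real.exp (-w ^ 2) := by gcongr
      _ = _ := e2
  have h5 : ouSubordinated t x y s = t / s ^ (3 / 2 : ℝ) * Real.exp (-(z ^ 2 / 4)) *
      (Real.exp (-w ^ 2) / (1 - Real.exp (-(2 * s))) ^ ((n : ℝ) / 2)) := by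
    unfold ouSubordinated; rw [hz4, hw2]
  have h6 : 0 ≤ t / s ^ (3 / 2 : ℝ) / (1 - Real.exp (-(2 * s))) ^ ((n : ℝ) / 2) := by positivity
  have h7 := mul_le_mul h3 h4 (by positivity) (by positivity)
  unfold ouSubordinatedDerivSpace
  rw [abs_mul, abs_of_nonneg (ouSubordinated_nonneg ht.le hs)]
  calc _ = ouSubordinated t x y s * (t * |2 * Real.exp (-s) *
        inner ℝ (y - Real.exp (-s) • x) v / (1 - Real.exp (-(2 * s)))|) := by ring
    _ ≤ ouSubordinated t x y s * (2 * z * w) :=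
        mul_le_mul_of_nonneg_left h2 (ouSubordinated_nonneg ht.le hs)
    _ = 2 * (t / s ^ (3 / 2 : ℝ) / (1 - Real.exp (-(2 * s))) ^ ((n : ℝ) / 2)) *
        (z * Real.exp (-(z ^ 2 / 4)) * (w * Real.exp (-w ^ 2))) := by rw [h5]; ring
    _ ≤ 2 * (t / s ^ (3 / 2 : ℝ) / (1 - Real.exp (-(2 * s))) ^ ((n : ℝ) / 2)) *
        (2 * Real.exp (-(1 / 8 * z ^ 2)) * Real.exp (-(1 / 8 * w ^ 2))) := by gcongr
    _ = _ := by unfold ouMajorant; rw [← hz2, ← hw2]; ring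

end

/-! ### Differentiation under the integral sign. -/

/-- Dropping the spatial exponential gives a dominating function that does not depend on `x` and
`y`. -/
theorem ouMajorant_le_zero {n : ℕ} {a t E s : ℝ} (ha : 0 ≤ a) (ht : 0 ≤ t) (hE : 0 ≤ E)
    (hs : 0 < s) : ouMajorant n a t E s ≤ ouMajorant n a t 0 s := by
  have h0 := one_sub_exp_neg_two_mul_pos hs
  have h1 : a * (0 / (1 - Real.exp (-(2 * s)))) ≤ a * (E / (1 - Real.exp (-(2 * s)))) := by
    gcongr
  unfold ouMajorant
  gcongr

theorem ouMajorant_le_of_mem_Ioo {n : ℕ} {a t τ s : ℝ} (ha : 0 ≤ a) (ht : 0 < t)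
    (hτ : τ ∈ Set.Ioo (t / 2) (2 * t)) (hs : 0 < s) :
    ouMajorant n a τ 0 s ≤ 4 * ouMajorant n a (t / 2) 0 s := by
  have h0 := one_sub_exp_neg_two_mul_pos hs
  obtain ⟨h1, h2⟩ := hτ
  have h3 : a * ((t / 2) ^ 2 / s) ≤ a * (τ ^ 2 / s) := by gcongr
  unfold ouMajorant
  calc _ ≤ (2 * t) / s ^ (3 / 2 : ℝ) * Real.exp (-(a * ((t / 2) ^ 2 / s))) *
      (Real.exp (-(a * (0 / (1 - Real.exp (-(2 * s)))))) /
      (1 - Real.exp (-(2 * s))) ^ ((n : ℝ) / 2)) := by gcongr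
    _ = _ := by ring

/-- This is the scalar estimate at `X = η = p = 0`, with `8000 / 64000 = 1/8`. -/
theorem integrableOn_ouMajorant_zero (n : ℕ) {t : ℝ} (ht : 0 < t) :
    IntegrableOn (ouMajorant n (1 / 8) t 0) (Set.Ioi 0) := by
  obtain ⟨C, -, H⟩ := exists_integral_ouMajorant_le n (c := 1 / 64000) (by norm_num)
  have := (H t 0 0 0 ht le_rfl le_rfl).1
  norm_num at this
  norm_num
  exact this

section Derivatives

variable {n : ℕ} (x y : EuclideanSpace ℝ (Fin n)) {t : ℝ}

theorem aestronglyMeasurable_ouSubordinated (t : ℝ) :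
    AEStronglyMeasurable (ouSubordinated t x y) (volume.restrict (Set.Ioi 0)) := by
  have : Measurable (ouSubordinated t x y) := by unfold ouSubordinated; fun_prop
  exact this.aestronglyMeasurable

theorem integrableOn_ouSubordinated (ht : 0 < t) :
    IntegrableOn (ouSubordinated t x y) (Set.Ioi 0) := by
  refine Integrable.mono' (integrableOn_ouMajorant_zero n ht)
    (aestronglyMeasurable_ouSubordinated x y t) ?_
  filter_upwards [ae_restrict_mem measurableSet_Ioi] with s hs
  rw [Real.norm_of_nonneg (ouSubordinated_nonneg ht.le hs)]
  exact (ouSubordinated_le ht.le hs).trans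
    (ouMajorant_le_zero (by norm_num) ht.le (by positivity) hs)

theorem hasDerivAt_integral_ouSubordinated_time (ht : 0 < t) :
    HasDerivAt (fun τ => ∫ s in Set.Ioi (0 : ℝ), ouSubordinated τ x y s)
      (∫ s in Set.Ioi (0 : ℝ), ouSubordinatedDerivTime t x y s) t := by
  refine (hasDerivAt_integral_of_dominated_loc_of_deriv_le
    (F' := fun τ s => ouSubordinatedDerivTime τ x y s)
    -- For `τ > t / 2` the derivative is at most `4 / τ ≤ 8 / t` times the majorant at `τ`, which is
    -- at most `4` times the majorant at `t / 2`.
    (bound := fun s => 32 / t * ouMajorant n (1 / 8) (t / 2) 0 s)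
    (Ioo_mem_nhds (by linarith : t / 2 < t) (by linarith : t < 2 * t))
    (Filter.Eventually.of_forall fun τ => aestronglyMeasurable_ouSubordinated x y τ)
    (integrableOn_ouSubordinated x y ht) ?_ ?_
    ((integrableOn_ouMajorant_zero n (half_pos ht)).const_mul _) ?_).2
  · have : Measurable (ouSubordinatedDerivTime t x y) := by
      unfold ouSubordinatedDerivTime; fun_prop
    exact this.aestronglyMeasurable
  · filter_upwards [ae_restrict_mem measurableSet_Ioi] with s hs τ hτ
    have hτ0 : 0 < τ := by linarith [hτ.1]
    have h1 := abs_ouSubordinatedDerivTime_le (x := x) (y := y) hτ0 hs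
    have h2 := ouMajorant_le_zero (n := n) (a := 1 / 8) (t := τ)
      (E := ‖y - Real.exp (-s) • x‖ ^ 2) (by norm_num) hτ0.le (by positivity) hs
    have h3 := ouMajorant_le_of_mem_Ioo (n := n) (a := 1 / 8) (by norm_num) ht hτ hs
    have h4 : t / 2 * |ouSubordinatedDerivTime τ x y s| ≤
        τ * |ouSubordinatedDerivTime τ x y s| :=
      mul_le_mul_of_nonneg_right hτ.1.le (abs_nonneg _)
    rw [Real.norm_eq_abs, div_mul_eq_mul_div, le_div_iff₀ ht]
    linarith
  · filter_upwards [ae_restrict_mem measurableSet_Ioi] with s hs τ _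
    exact hasDerivAt_ouSubordinated_time x y τ hs

theorem hasLineDerivAt_integral_ouSubordinated {v : EuclideanSpace ℝ (Fin n)} (hv : ‖v‖ ≤ 1)
    (ht : 0 < t) :
    HasLineDerivAt ℝ (fun z => ∫ s in Set.Ioi (0 : ℝ), ouSubordinated t z y s)
      (∫ s in Set.Ioi (0 : ℝ), ouSubordinatedDerivSpace t x y v s) x v := by
  have h := (hasDerivAt_integral_of_dominated_loc_of_deriv_le (x₀ := (0 : ℝ)) (s := Set.univ)
    (μ := volume.restrict (Set.Ioi (0 : ℝ)))
    (F := fun (h : ℝ) s => ouSubordinated t (x + h • v) y s)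
    (F' := fun (h : ℝ) s => ouSubordinatedDerivSpace t (x + h • v) y v s)
    -- The bound is uniform along the whole line, so the neighbourhood can be all of `ℝ`.
    (bound := fun s => 4 / t * ouMajorant n (1 / 8) t 0 s) Filter.univ_mem
    (Filter.Eventually.of_forall fun h => aestronglyMeasurable_ouSubordinated (x + h • v) y t)
    (integrableOn_ouSubordinated _ y ht) ?_ ?_
    ((integrableOn_ouMajorant_zero n ht).const_mul _)
    (Filter.Eventually.of_forall fun s h _ => hasDerivAt_ouSubordinated_line t s h x y v)).2
  · simp only [zero_smul, add_zero] at h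
    exact h
  · have : Measurable (ouSubordinatedDerivSpace t (x + (0 : ℝ) • v) y v) := by
      unfold ouSubordinatedDerivSpace ouSubordinated; fun_prop
    exact this.aestronglyMeasurable
  · filter_upwards [ae_restrict_mem measurableSet_Ioi] with s hs h _
    have h1 := abs_ouSubordinatedDerivSpace_le (x := x + h • v) (y := y) ht hs hv
    have h2 := ouMajorant_le_zero (n := n) (a := 1 / 8) (t := t)
      (E := ‖y - Real.exp (-s) • (x + h • v)‖ ^ 2) (by norm_num) ht.le (by positivity) hs
    rw [Real.norm_eq_abs, div_mul_eq_mul_div, le_div_iff₀ ht]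
    linarith

end Derivatives

/-! ### Convergence in the variable `u`, and the theorem. -/

theorem integrableOn_ouPoissonIntegrand {n : ℕ} {t : ℝ} (ht : 0 < t)
    (x y : EuclideanSpace ℝ (Fin n)) :
    IntegrableOn (ouPoissonIntegrand t x y) (Set.Ioi 0) := by
  have himg : (fun s : ℝ => t ^ 2 / (4 * s)) '' Set.Ioi 0 = Set.Ioi 0 := by
    ext u
    constructor
    · rintro ⟨s, hs, rfl⟩
      have hs' : 0 < s := hs
      exact Set.mem_Ioi.2 (by positivity)
    · intro hu
      have hu' : 0 < u := hu
      refine ⟨t ^ 2 / (4 * u), Set.mem_Ioi.2 (by positivity), ?_⟩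
      simp only
      field_simp
  have hder : ∀ s ∈ Set.Ioi (0 : ℝ),
      HasDerivWithinAt (fun s : ℝ => t ^ 2 / (4 * s)) (-(t ^ 2 / (4 * s ^ 2))) (Set.Ioi 0) s := by
    intro s hs
    have hs' : s ≠ 0 := ne_of_gt hs
    have h := ((hasDerivAt_inv hs').const_mul (t ^ 2 / 4)).hasDerivWithinAt (s := Set.Ioi 0)
    refine (h.congr_deriv (by field_simp)).congr (fun z _ => ?_) ?_ <;>
    · simp only [div_eq_mul_inv, mul_inv]
      ring
  have hinj : Set.InjOn (fun s : ℝ => t ^ 2 / (4 * s)) (Set.Ioi 0) := by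
    intro a ha b hb hab
    have ha' : 0 < a := ha
    have hb' : 0 < b := hb
    simp only at hab
    field_simp at hab
    exact hab.symm
  rw [← himg, integrableOn_image_iff_integrableOn_abs_deriv_smul measurableSet_Ioi hder hinj]
  refine IntegrableOn.congr_fun ((integrableOn_ouSubordinated x y ht).const_mul
    (1 / (2 * Real.pi ^ ((n : ℝ) / 2)))) (fun s hs => ?_) measurableSet_Ioi
  have hs' : 0 < s := hs
  have h1 : t ^ 2 / (4 * (t ^ 2 / (4 * s))) = s := by field_simp
  have h2 : Real.exp (-s) ^ 2 = Real.exp (-(2 * s)) := by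
    rw [← Real.exp_nat_mul]; congr 1; push_cast; ring
  have h3 : √(t ^ 2 / (4 * s)) = t / (2 * √s) := by
    rw [Real.sqrt_eq_iff_mul_self_eq_of_pos (by positivity)]
    field_simp
    rw [Real.sq_sqrt hs'.le]; ring
  have h4 : s ^ (3 / 2 : ℝ) = s * √s := by
    rw [Real.sqrt_eq_rpow, show (3 / 2 : ℝ) = 1 + 1 / 2 by norm_num, Real.rpow_add hs',
      Real.rpow_one]
  simp only [ouSubordinated, ouPoissonIntegrand, ouKernel, mehlerKernel, smul_eq_mul]
  rw [h1, h2, h3, h4, abs_neg, abs_of_nonneg (by positivity), Real.rpow_neg Real.pi_pos.le]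
  generalize Real.exp (-(‖y - Real.exp (-s) • x‖ ^ 2 / (1 - Real.exp (-(2 * s))))) /
          (1 - Real.exp (-(2 * s))) ^ ((n : ℝ) / 2) = m
  have hpi : Real.pi ^ ((n : ℝ) / 2) ≠ 0 := (Real.rpow_pos_of_pos Real.pi_pos _).ne'
  field_simp
  rw [Real.sq_sqrt hs'.le]
  ring

theorem theorem1p3 (n : ℕ) :
    ∃ C c : ℝ, 0 < C ∧ 0 < c ∧
      ∀ (i : Fin n) (t : ℝ), 0 < t → ∀ x y : EuclideanSpace ℝ (Fin n),
        MeasureTheory.IntegrableOn (ouPoissonIntegrand t x y) (Set.Ioi 0) ∧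
        DifferentiableAt ℝ (fun τ : ℝ => ouPoissonKernel τ x y) t ∧
        LineDifferentiableAt ℝ (fun z : EuclideanSpace ℝ (Fin n) => ouPoissonKernel t z y) x
          (EuclideanSpace.single i 1) ∧
        |t * deriv (fun τ : ℝ => ouPoissonKernel τ x y) t| +
          |t * lineDeriv ℝ (fun z : EuclideanSpace ℝ (Fin n) => ouPoissonKernel t z y) x
            (EuclideanSpace.single i 1)| ≤
          C * (ouK1 c t x y + ouK2 c t x y + ouK3 c t x y + ouK4 c t x y) := by
  obtain ⟨C, hC, H⟩ := exists_integral_ouMajorant_le_kernels n (c := 1 / 64000) (by norm_num)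
  rw [show (8000 * (1 / 64000) : ℝ) = 1 / 8 by norm_num] at H
  obtain ⟨A, hA⟩ : ∃ A : ℝ, A = 1 / (2 * Real.pi ^ (((n : ℝ) + 1) / 2)) := ⟨_, rfl⟩
  have hA0 : 0 < A := by rw [hA]; positivity
  -- The value of `c` solves `8000 c = 1/8`; the factor `8` is `4 + 4`, from the two derivatives.
  refine ⟨A * (8 * C), 1 / 64000, by positivity, by norm_num, fun i t ht x y => ?_⟩
  have hv : ‖(EuclideanSpace.single i 1 : EuclideanSpace ℝ (Fin n))‖ ≤ 1 := by simp
  -- Only `‖v‖ ≤ 1` matters, so the constants do not depend on `i`.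
  generalize (EuclideanSpace.single i 1 : EuclideanSpace ℝ (Fin n)) = v at hv ⊢
  obtain ⟨hint, hle⟩ := H t ht x y
  have hker : ∀ τ : ℝ, 0 < τ → ∀ z : EuclideanSpace ℝ (Fin n),
      ouPoissonKernel τ z y = A * ∫ s in Set.Ioi (0 : ℝ), ouSubordinated τ z y s := by
    intro τ hτ z
    rw [hA]
    exact ouPoissonKernel_eq hτ z y
  have hT : HasDerivAt (fun τ : ℝ => ouPoissonKernel τ x y)
      (A * ∫ s in Set.Ioi (0 : ℝ), ouSubordinatedDerivTime t x y s) t := by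
    -- The formula for the kernel is available only for `τ > 0`, hence equality near `t`.
    refine ((hasDerivAt_integral_ouSubordinated_time x y ht).const_mul A).congr_of_eventuallyEq ?_
    filter_upwards [lt_mem_nhds ht] with τ hτ using hker τ hτ x
  have hS : HasLineDerivAt ℝ (fun z : EuclideanSpace ℝ (Fin n) => ouPoissonKernel t z y)
      (A * ∫ s in Set.Ioi (0 : ℝ), ouSubordinatedDerivSpace t x y v s) x v := by
    have h : HasDerivAt (fun h : ℝ => ∫ s in Set.Ioi (0 : ℝ), ouSubordinated t (x + h • v) y s)
        (∫ s in Set.Ioi (0 : ℝ), ouSubordinatedDerivSpace t x y v s) 0 :=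
      hasLineDerivAt_integral_ouSubordinated x y hv ht
    simp only [hker t ht]
    exact h.const_mul A
  refine ⟨integrableOn_ouPoissonIntegrand ht x y, hT.differentiableAt,
    hS.lineDifferentiableAt, ?_⟩
  rw [hT.deriv, hS.lineDeriv]
  have key : ∀ f : ℝ → ℝ, (∀ s, 0 < s → t * |f s| ≤
      4 * ouMajorant n (1 / 8) t (‖y - Real.exp (-s) • x‖ ^ 2) s) →
      |t * (A * ∫ s in Set.Ioi (0 : ℝ), f s)| ≤ A * (4 * ∫ s in Set.Ioi (0 : ℝ),
        ouMajorant n (1 / 8) t (‖y - Real.exp (-s) • x‖ ^ 2) s) := by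
    intro f hf
    rw [mul_left_comm, ← integral_const_mul, abs_mul, abs_of_pos hA0, ← integral_const_mul]
    refine mul_le_mul_of_nonneg_left ?_ hA0.le
    rw [← Real.norm_eq_abs]
    refine norm_integral_le_of_norm_le (hint.const_mul 4) ?_
    filter_upwards [ae_restrict_mem measurableSet_Ioi] with s hs
    rw [Real.norm_eq_abs, abs_mul, abs_of_pos ht]
    exact hf s hs
  have b1 := key _ fun s hs => abs_ouSubordinatedDerivTime_le (x := x) (y := y) ht hs
  have b2 := key _ fun s hs => abs_ouSubordinatedDerivSpace_le (x := x) (y := y) ht hs hv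
  have b3 := mul_le_mul_of_nonneg_left hle (by positivity : 0 ≤ A * 8)
  linarith
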